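/- Let $\Gamma=\mathrm{PSL}_2(\mathbb Z)$ act on the upper half-plane $\mathbb H$, put $\rho=e^{\pi i/3}$, let $\mathbf r$ be the hyperbolic segment joining $i$ and $\rho$, and let $\triangle\subset\mathbb H$ be the hyperbolic triangle with vertices $0,\rho,\infty$ without its ideal vertices $0,\infty$. Let $\mathcal T$ be the tree formed by the $\Gamma$-copies of $\mathbf r$; its vertices are the $\Gamma$-copies of $i$ (type (0)) and of $\rho$ (type (1)), and the edges at a vertex of type (1) are cyclically ordered counterclockwise. Let $p:\mathbb H\to\mathcal T$ be a $\Gamma$-equivariant retraction whose restriction to $\triangle$ is a continuous retraction onto $\mathbf r$ that takes the points of the imaginary half-axis, and no others, to $i$ and the points of the two sides issuing from $\rho$, and no others, to $\rho$. Let $\gamma_0,\gamma_1\in\Gamma$ be the classes of $\left(\begin{smallmatrix}0&-1\\1&0\end{smallmatrix}\right)$ and $\left(\begin{smallmatrix}0&1\\-1&1\end{smallmatrix}\right)$ and let $G_0=\langle\gamma_0\rangle$, $G_1=\langle\gamma_1\rangle$. Let $G\subset\Gamma$ be a subgroup. The graph $X_{\mathrm{comb}}(G)$ has the set of edges $G\backslash\Gamma$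 and the set of vertices $(G\backslash\Gamma/G_0)\sqcup(G\backslash\Gamma/G_1)$ (types (0) and (1)), and an edge $x$ joins the $G_0$-orbit and the $G_1$-orbit of $x$; the edges at a trivalent vertex are cyclically ordered by $x,\,x\gamma_1,\,x\gamma_1^2$. Let $\mathbf T=X_{\mathrm{comb}}(\{1\})$, with edges the elements of $\Gamma$, and let $f:\mathbf T\to\mathcal T$ be the $\Gamma$-equivariant isomorphism that takes the edge $g$ to $g\mathbf r$, the vertex $gG_0$ to $g\,i$ and the vertex $gG_1$ to $g\rho$. Cut $X_{\mathrm{comb}}(G)$ in some of its vertices of valency $2$ so that the resulting graph $X'$ is a tree, let $\mathbf r'$ be the edge of $X'$ given by the coset $G\in G\backslash\Gamma$, and let $V_0'$, $V_1'$ be its extremities of types (0) and (1). Then there is a unique embedding of graphs $\imath:X'\to\mathcal T$ that takes $V_0'$ to $i$ and $V_1'$ to $\rho$ and preserves the types of the vertices and the cyclic order of the edges at each trivalent vertex of type (1). Every edge $r$ of $\mathcal T$ in the image of $\imath$ can be written as $r=g_r\mathbf r$ for a unique $g_r\in\Gamma$. Let $U=\bigcup_r g_r\triangle$, the union being over all edges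 $r$ of $\mathcal T$ in the image of $\imath$. Let $\jmath:X'\to\mathbf T$ be a lift of the natural map $X'\to X_{\mathrm{comb}}(G)=G\backslash\mathbf T$, and let $P_\jmath$ be the closure of the interior of $p^{-1}(f(\jmath(X')))$ in $\mathbb H$. If $\jmath$ takes $\mathbf r'$ to the edge $1$ of $\mathbf T$, then $P_\jmath=U$. For an arbitrary lift, $P_\jmath=\gamma U$, where $\gamma\in\Gamma$ is the edge $\jmath(\mathbf r')$ of $\mathbf T$. If moreover $X'$ has no univalent vertices of type (1), then the preimage itself is $p^{-1}(f(\jmath(X')))=\gamma U$. -/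

import Mathlib

open UpperHalfPlane
open scoped MatrixGroups Pointwise

noncomputable section

namespace ModularTree

/-! ### The modular group and its action on the upper half-plane -/

lemma center_smul_eq (A : SL(2, ℤ)) (hA : A ∈ Subgroup.center SL(2, ℤ)) (z : ℍ) : A • z = z := by
  obtain ⟨r, hr, hrA⟩ := Matrix.SpecialLinearGroup.mem_center_iff.mp hA
  have h00 : A 0 0 = r := by
    rw [← hrA, Matrix.scalar_apply, Matrix.diagonal_apply_eq]
  have h01 : A 0 1 = 0 := by
    rw [← hrA, Matrix.scalar_apply, Matrix.diagonal_apply_ne _ (by decide)]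
  have h10 : A 1 0 = 0 := by
    rw [← hrA, Matrix.scalar_apply, Matrix.diagonal_apply_ne _ (by decide)]
  have h11 : A 1 1 = r := by
    rw [← hrA, Matrix.scalar_apply, Matrix.diagonal_apply_eq]
  have hr0 : (r : ℂ) ≠ 0 := by
    have hr0 : r ≠ 0 := by
      rintro rfl
      simp at hr
    exact_mod_cast hr0
  ext
  rw [coe_specialLinearGroup_apply, h00, h01, h10, h11]
  simp only [eq_intCast, Complex.ofReal_intCast, Int.cast_zero, Complex.ofReal_zero, add_zero,
    zero_mul, zero_add]
  field_simp

/-- The action of `PSL(2, ℤ)` on the upper half-plane by Möbius transformations, induced by the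
action of `SL(2, ℤ)`. -/
instance pslAction : MulAction PSL(2, ℤ) ℍ :=
  MulAction.compHom ℍ
    (QuotientGroup.lift (Subgroup.center SL(2, ℤ)) (MulAction.toPermHom SL(2, ℤ) ℍ)
      (fun A hA => Equiv.ext (center_smul_eq A hA)))

lemma mk_smul (A : SL(2, ℤ)) (z : ℍ) : (QuotientGroup.mk A : PSL(2, ℤ)) • z = A • z := rfl

/-- The matrix `(0 -1; 1 0)`. -/
def mat₀ : SL(2, ℤ) := ⟨!![0, -1; 1, 0], by norm_num [Matrix.det_fin_two_of]⟩

/-- The matrix `(0 1; -1 1)`. -/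
def mat₁ : SL(2, ℤ) := ⟨!![0, 1; -1, 1], by norm_num [Matrix.det_fin_two_of]⟩

/-- The class of the matrix `(0 -1; 1 0)`. -/
def gen₀ : PSL(2, ℤ) := QuotientGroup.mk mat₀

/-- The class of the matrix `(0 1; -1 1)`. -/
def gen₁ : PSL(2, ℤ) := QuotientGroup.mk mat₁

/-- The subgroup `G₀` (of order 2). -/
def G₀ : Subgroup PSL(2, ℤ) := Subgroup.zpowers gen₀

/-- The subgroup `G₁` (of order 3). -/
def G₁ : Subgroup PSL(2, ℤ) := Subgroup.zpowers gen₁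

/-! ### Bipartite graphs, possibly with multiple edges -/

/-- A graph (multiple edges allowed) whose vertices are divided into types (0) and (1), such that
every edge joins a vertex of type (0) with a vertex of type (1). -/
structure BiGraph where
  V₀ : Type
  V₁ : Type
  E : Type
  /-- the extremity of type (0) of an edge -/
  end₀ : E → V₀
  /-- the extremity of type (1) of an edge -/
  end₁ : E → V₁

namespace BiGraph

/-- Graph morphisms that preserve the types of the vertices. -/
@[ext]
structure Hom (X Y : BiGraph) where
  v₀ : X.V₀ → Y.V₀
  v₁ : X.V₁ → Y.V₁
  e : X.E → Y.E
  end₀_e : ∀ x, Y.end₀ (e x) = v₀ (X.end₀ x)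
  end₁_e : ∀ x, Y.end₁ (e x) = v₁ (X.end₁ x)

/-- The composite `g ∘ f`. -/
def Hom.comp {X Y Z : BiGraph} (g : Hom Y Z) (f : Hom X Y) : Hom X Z where
  v₀ := g.v₀ ∘ f.v₀
  v₁ := g.v₁ ∘ f.v₁
  e := g.e ∘ f.e
  end₀_e x := by simp [g.end₀_e, f.end₀_e]
  end₁_e x := by simp [g.end₁_e, f.end₁_e]

/-- The valency of a vertex of type (0). -/
def valency₀ (X : BiGraph) (v : X.V₀) : ℕ∞ := {x : X.E | X.end₀ x = v}.encard

/-- The valency of a vertex of type (1). -/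
def valency₁ (X : BiGraph) (v : X.V₁) : ℕ∞ := {x : X.E | X.end₁ x = v}.encard

/-- The underlying simple graph, on all the vertices. -/
def toSimpleGraph (X : BiGraph) : SimpleGraph (X.V₀ ⊕ X.V₁) :=
  SimpleGraph.fromRel fun a b => ∃ x, a = Sum.inl (X.end₀ x) ∧ b = Sum.inr (X.end₁ x)

/-- A graph is a tree if it has no multiple edges and the underlying simple graph is connected
and acyclic. -/
def IsTree (X : BiGraph) : Prop :=
  (∀ x y : X.E, X.end₀ x = X.end₀ y → X.end₁ x = X.end₁ y → x = y) ∧ X.toSimpleGraph.IsTree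

open Classical in
/-- The graph obtained by cutting `X` in the vertices of a set `C` of vertices of type (0): each
`v ∈ C` is replaced by univalent vertices, one for each edge that ends in `v`. The edges and the
vertices of type (1) stay the same. -/
def cut (X : BiGraph) (C : Set X.V₀) : BiGraph where
  V₀ := {v : X.V₀ // v ∉ C} ⊕ {x : X.E // X.end₀ x ∈ C}
  V₁ := X.V₁
  E := X.E
  end₀ x := if h : X.end₀ x ∈ C then Sum.inr ⟨x, h⟩ else Sum.inl ⟨X.end₀ x, h⟩
  end₁ := X.end₁

/-- The map that glues the cut graph back together. -/
def cutProj (X : BiGraph) (C : Set X.V₀) : Hom (X.cut C) X where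
  v₀ := Sum.elim (fun v => v.1) (fun x => X.end₀ x.1)
  v₁ := id
  e := id
  end₀_e x := by
    simp only [cut, id]
    split_ifs <;> rfl
  end₁_e _ := rfl

end BiGraph

open BiGraph

/-! ### The graph `X_comb(G)` and the tree `T` -/

/-- The set `G \ Γ` of right cosets `G g`. -/
abbrev RightCosets (G : Subgroup PSL(2, ℤ)) : Type := Quotient (QuotientGroup.rightRel G)

/-- The map `G \ Γ → G \ Γ / H`, sending a right coset to its `H`-orbit. -/
def toDoubleCoset (G H : Subgroup PSL(2, ℤ)) :
    RightCosets G → DoubleCoset.Quotient (G : Set PSL(2, ℤ)) (H : Set PSL(2, ℤ)) :=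
  Quotient.lift (fun g => Quotient.mk (DoubleCoset.setoid (G : Set PSL(2, ℤ)) H) g) (by
    intro a b hab
    refine Quotient.sound (DoubleCoset.rel_iff.mpr ?_)
    have h : b * a⁻¹ ∈ G := QuotientGroup.rightRel_apply.mp hab
    exact ⟨b * a⁻¹, h, 1, H.one_mem, by group⟩)

/-- The graph `X_comb(G)`: the edges are the elements of `G \ Γ`, the vertices of type `(i)` are
the `G_i`-orbits in `G \ Γ`, and an edge `x` ends in the orbits that contain `x`. -/
def Xcomb (G : Subgroup PSL(2, ℤ)) : BiGraph where
  V₀ := DoubleCoset.Quotient (G : Set PSL(2, ℤ)) (G₀ : Set PSL(2, ℤ))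
  V₁ := DoubleCoset.Quotient (G : Set PSL(2, ℤ)) (G₁ : Set PSL(2, ℤ))
  E := RightCosets G
  end₀ := toDoubleCoset G G₀
  end₁ := toDoubleCoset G G₁

/-- The distinguished edge of `X_comb(G)`: the coset `G` itself. -/
def distEdge (G : Subgroup PSL(2, ℤ)) : (Xcomb G).E :=
  Quotient.mk (QuotientGroup.rightRel G) 1

/-- The map `x ↦ x · (0 1; -1 1)` on `G \ Γ`. The cyclic order of the edges `x` that meet in a
trivalent vertex of `X_comb(G)` is `x, nextEdge x, nextEdge (nextEdge x)`. -/
def nextEdge (G : Subgroup PSL(2, ℤ)) : (Xcomb G).E → (Xcomb G).E :=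
  Quotient.map (fun g => g * gen₁) (by
    intro a b hab
    have h : b * a⁻¹ ∈ G := QuotientGroup.rightRel_apply.mp hab
    refine QuotientGroup.rightRel_apply.mpr ?_
    simpa [mul_assoc] using h)

/-- The tree `T`: the edges are the elements `g` of `Γ`, the vertices of type `(i)` are the left
cosets of `G_i`, and `g` ends in the cosets that contain `g`. -/
def T : BiGraph where
  V₀ := PSL(2, ℤ) ⧸ G₀
  V₁ := PSL(2, ℤ) ⧸ G₁
  E := PSL(2, ℤ)
  end₀ := QuotientGroup.mk
  end₁ := QuotientGroup.mk

/-- The map `Γ / H → G \ Γ / H`. -/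
def leftToDoubleCoset (G H : Subgroup PSL(2, ℤ)) :
    PSL(2, ℤ) ⧸ H → DoubleCoset.Quotient (G : Set PSL(2, ℤ)) (H : Set PSL(2, ℤ)) :=
  Quotient.lift (fun g => Quotient.mk (DoubleCoset.setoid (G : Set PSL(2, ℤ)) H) g) (by
    intro a b hab
    refine Quotient.sound (DoubleCoset.rel_iff.mpr ?_)
    have h : a⁻¹ * b ∈ H := QuotientGroup.leftRel_apply.mp hab
    exact ⟨1, G.one_mem, a⁻¹ * b, h, by group⟩)

/-- The quotient map `T → G \ T = X_comb(G)`. -/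
def quotMap (G : Subgroup PSL(2, ℤ)) : Hom T (Xcomb G) where
  v₀ := leftToDoubleCoset G G₀
  v₁ := leftToDoubleCoset G G₁
  e := fun g => Quotient.mk (QuotientGroup.rightRel G) g
  end₀_e _ := rfl
  end₁_e _ := rfl

/-- The graph `X'` obtained by cutting `X_comb(G)` in the vertices of `C`. -/
abbrev cutGraph (G : Subgroup PSL(2, ℤ)) (C : Set (Xcomb G).V₀) : BiGraph := (Xcomb G).cut C

/-- `j` is a lift of `X'` into `T`: the composite `X' → T → X_comb(G)` is the canonical map. -/
def IsLift {G : Subgroup PSL(2, ℤ)} {C : Set (Xcomb G).V₀} (j : Hom (cutGraph G C) T) : Prop :=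
  (quotMap G).comp j = (Xcomb G).cutProj C

/-- The edge of `T`, i.e. the element of `Γ`, to which `j` takes the distinguished edge. -/
def baseElt {G : Subgroup PSL(2, ℤ)} {C : Set (Xcomb G).V₀} (j : Hom (cutGraph G C) T) :
    PSL(2, ℤ) := j.e (distEdge G)

/-! ### The tree `𝒯` in the upper half-plane -/

/-- The point `e^{πi/3}`. -/
def rho : ℍ := ⟨⟨1 / 2, √3 / 2⟩, by positivity⟩

/-- The hyperbolic segment joining `i` and `e^{πi/3}`, which is an arc of the unit circle. -/
def seg : Set ℍ := {z | ‖(z : ℂ)‖ = 1 ∧ 0 ≤ z.re ∧ z.re ≤ 1 / 2}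

/-- The hyperbolic triangle with vertices `0`, `e^{πi/3}`, `∞`, minus the vertices `0`, `∞`. Its
sides lie on the geodesics `Re z = 0`, `Re z = 1 / 2` and `|z - 1| = 1`. -/
def triangle : Set ℍ := {z | 0 ≤ z.re ∧ z.re ≤ 1 / 2 ∧ 1 ≤ ‖(z : ℂ) - 1‖}

lemma seg_sq {z : ℍ} (hz : z ∈ seg) : z.re ^ 2 + z.im ^ 2 = 1 := by
  have h : Complex.normSq (z : ℂ) = 1 := by rw [Complex.normSq_eq_norm_sq, hz.1]; norm_num
  rw [Complex.normSq_apply, coe_re, coe_im] at h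
  nlinarith

lemma I_mem_seg : (I : ℍ) ∈ seg := by
  refine ⟨by simp, by simp, by simp⟩

lemma rho_mem_seg : rho ∈ seg := by
  have h3 : √3 ^ 2 = 3 := Real.sq_sqrt (by norm_num)
  refine ⟨?_, by simp [rho, UpperHalfPlane.re], by simp [rho, UpperHalfPlane.re]⟩
  have h : Complex.normSq (rho : ℂ) = 1 := by
    rw [Complex.normSq_apply]
    change (1 / 2 : ℝ) * (1 / 2) + √3 / 2 * (√3 / 2) = 1
    nlinarith
  rw [Complex.normSq_eq_norm_sq] at h
  have := norm_nonneg (rho : ℂ)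
  nlinarith

lemma smul_I_mem_seg {k : PSL(2, ℤ)} (hk : k • (I : ℍ) ∈ seg) : k • (I : ℍ) = I := by
  induction k using QuotientGroup.induction_on with | H A =>
  rw [mk_smul] at hk ⊢
  set z := A • (I : ℍ) with hz
  have h1 := seg_sq hk
  have him : z.im = 1 / ((A 1 0 : ℝ) ^ 2 + (A 1 1 : ℝ) ^ 2) := by
    rw [hz, ModularGroup.im_smul_eq_div_normSq, ModularGroup.denom_apply, Complex.normSq_apply]
    simp
    ring
  have hpos := z.im_pos
  have hint : (A 1 0) ^ 2 + (A 1 1) ^ 2 = 1 := by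
    by_contra hne
    have h0 : 0 ≤ (A 1 0) ^ 2 + (A 1 1) ^ 2 := by positivity
    rcases (by omega : (A 1 0) ^ 2 + (A 1 1) ^ 2 = 0 ∨ 2 ≤ (A 1 0) ^ 2 + (A 1 1) ^ 2) with h | h
    · have : ((A 1 0 : ℝ)) ^ 2 + (A 1 1 : ℝ) ^ 2 = 0 := by exact_mod_cast h
      rw [this] at him
      simp at him
      linarith
    · have h2 : (2 : ℝ) ≤ (A 1 0 : ℝ) ^ 2 + (A 1 1 : ℝ) ^ 2 := by exact_mod_cast h
      have : z.im ≤ 1 / 2 := by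
        rw [him]
        exact one_div_le_one_div_of_le (by norm_num) h2
      nlinarith [hk.2.1, hk.2.2]
  have him1 : z.im = 1 := by
    have : ((A 1 0 : ℝ)) ^ 2 + (A 1 1 : ℝ) ^ 2 = 1 := by exact_mod_cast hint
    rw [him, this]; norm_num
  have hre : z.re = 0 := by nlinarith
  exact UpperHalfPlane.ext (Complex.ext (by simpa using hre) (by simpa using him1))

lemma smul_rho_mem_seg {k : PSL(2, ℤ)} (hk : k • rho ∈ seg) : k • rho = rho := by
  induction k using QuotientGroup.induction_on with | H A =>
  rw [mk_smul] at hk ⊢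
  set z := A • rho with hz
  have h3 : √3 ^ 2 = 3 := Real.sq_sqrt (by norm_num)
  have h30 : 0 < √3 := by positivity
  have h1 := seg_sq hk
  have hrr : (rho : ℂ).re = 1 / 2 := rfl
  have hri : (rho : ℂ).im = √3 / 2 := rfl
  have hri' : rho.im = √3 / 2 := rfl
  have him : z.im = √3 / 2 /
      ((A 1 0 : ℝ) ^ 2 + (A 1 0 : ℝ) * (A 1 1 : ℝ) + (A 1 1 : ℝ) ^ 2) := by
    rw [hz, ModularGroup.im_smul_eq_div_normSq, ModularGroup.denom_apply, Complex.normSq_apply,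
      hri']
    congr 1
    simp only [Complex.add_re, Complex.add_im, Complex.mul_re, Complex.mul_im,
      Complex.intCast_re, Complex.intCast_im, hrr, hri]
    nlinarith
  have hpos := z.im_pos
  have hge : √3 / 2 ≤ z.im := by
    nlinarith [hk.2.1, hk.2.2]
  have hint : (A 1 0) ^ 2 + (A 1 0) * (A 1 1) + (A 1 1) ^ 2 = 1 := by
    by_contra hne
    have h0 : 0 ≤ (A 1 0) ^ 2 + (A 1 0) * (A 1 1) + (A 1 1) ^ 2 := by
      nlinarith [sq_nonneg (A 1 0 + A 1 1), sq_nonneg (A 1 0), sq_nonneg (A 1 1)]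
    rcases (by omega : (A 1 0) ^ 2 + (A 1 0) * (A 1 1) + (A 1 1) ^ 2 = 0 ∨
        2 ≤ (A 1 0) ^ 2 + (A 1 0) * (A 1 1) + (A 1 1) ^ 2) with h | h
    · have : (A 1 0 : ℝ) ^ 2 + (A 1 0 : ℝ) * (A 1 1 : ℝ) + (A 1 1 : ℝ) ^ 2 = 0 := by
        exact_mod_cast h
      rw [this] at him
      simp at him
      linarith
    · have h2 : (2 : ℝ) ≤ (A 1 0 : ℝ) ^ 2 + (A 1 0 : ℝ) * (A 1 1 : ℝ) + (A 1 1 : ℝ) ^ 2 := by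
        exact_mod_cast h
      have : z.im ≤ √3 / 2 / 2 := by
        rw [him]
        exact div_le_div_of_nonneg_left (by positivity) (by norm_num) h2
      linarith
  have him1 : z.im = √3 / 2 := by
    have : (A 1 0 : ℝ) ^ 2 + (A 1 0 : ℝ) * (A 1 1 : ℝ) + (A 1 1 : ℝ) ^ 2 = 1 := by
      exact_mod_cast hint
    rw [him, this]; norm_num
  have hre : z.re = 1 / 2 := by
    have : z.re ^ 2 = 1 / 4 := by rw [him1] at h1; nlinarith
    nlinarith [hk.2.1]
  exact UpperHalfPlane.ext (Complex.ext hre him1)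

lemma existsUnique_mem {z : ℍ} (hz : z ∈ seg)
    (h : ∀ k : PSL(2, ℤ), k • z ∈ seg → k • z = z) (g : PSL(2, ℤ)) (w : ℍ) :
    (w ∈ MulAction.orbit PSL(2, ℤ) z ∧ w ∈ g • seg) ↔ w = g • z := by
  constructor
  · rintro ⟨⟨k, rfl⟩, hk⟩
    rw [Set.mem_smul_set_iff_inv_smul_mem] at hk
    change g⁻¹ • k • z ∈ seg at hk
    have := h (g⁻¹ * k) (by rwa [mul_smul])
    rw [mul_smul, inv_smul_eq_iff] at this
    exact this
  · rintro rfl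
    exact ⟨MulAction.mem_orbit _ _, Set.smul_mem_smul_set hz⟩

lemma exists_mem_edge {z : ℍ} (hz : z ∈ seg)
    (s : MulAction.orbit PSL(2, ℤ) seg) :
    ∃ v : MulAction.orbit PSL(2, ℤ) z, (v : ℍ) ∈ (s : Set ℍ) := by
  obtain ⟨_, g, rfl⟩ := s
  exact ⟨⟨g • z, MulAction.mem_orbit _ _⟩, Set.smul_mem_smul_set hz⟩

/-- The tree `𝒯`: the edges are the `Γ`-copies of the segment `seg` (as subsets of `ℍ`), the
vertices of type (0), resp. (1), are the `Γ`-copies of `i`, resp. of `e^{πi/3}`; the extremity of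
type (0), resp. (1), of an edge is the only vertex of this type that lies on it. -/
def treeH : BiGraph where
  V₀ := MulAction.orbit PSL(2, ℤ) (I : ℍ)
  V₁ := MulAction.orbit PSL(2, ℤ) rho
  E := MulAction.orbit PSL(2, ℤ) seg
  end₀ s := (exists_mem_edge I_mem_seg s).choose
  end₁ s := (exists_mem_edge rho_mem_seg s).choose

/-- A vertex of type (0) of `𝒯` as a point of `ℍ`. -/
def pt₀ (v : treeH.V₀) : ℍ := Subtype.val (p := (· ∈ MulAction.orbit PSL(2, ℤ) (I : ℍ))) v

/-- A vertex of type (1) of `𝒯` as a point of `ℍ`. -/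
def pt₁ (v : treeH.V₁) : ℍ := Subtype.val (p := (· ∈ MulAction.orbit PSL(2, ℤ) rho)) v

/-- An edge of `𝒯` as a subset of `ℍ`. -/
def edgeSet (s : treeH.E) : Set ℍ := Subtype.val (p := (· ∈ MulAction.orbit PSL(2, ℤ) seg)) s

/-- The edge `g • seg` of `𝒯`. -/
def edgeOf (g : PSL(2, ℤ)) : treeH.E :=
  (⟨g • seg, MulAction.mem_orbit _ _⟩ : MulAction.orbit PSL(2, ℤ) seg)

lemma pt₀_end₀_edgeOf (g : PSL(2, ℤ)) : pt₀ (treeH.end₀ (edgeOf g)) = g • (I : ℍ) := by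
  refine (existsUnique_mem I_mem_seg (fun _ => smul_I_mem_seg) g _).mp ⟨Subtype.property _, ?_⟩
  exact (exists_mem_edge I_mem_seg (edgeOf g)).choose_spec

lemma pt₁_end₁_edgeOf (g : PSL(2, ℤ)) : pt₁ (treeH.end₁ (edgeOf g)) = g • rho := by
  refine (existsUnique_mem rho_mem_seg (fun _ => smul_rho_mem_seg) g _).mp ⟨Subtype.property _, ?_⟩
  exact (exists_mem_edge rho_mem_seg (edgeOf g)).choose_spec

lemma gen₀_smul_I : gen₀ • (I : ℍ) = I := by
  rw [gen₀, mk_smul]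
  ext
  rw [coe_specialLinearGroup_apply]
  simp [mat₀]

lemma gen₁_smul_rho : gen₁ • rho = rho := by
  have h3 : √3 ^ 2 = 3 := Real.sq_sqrt (by norm_num)
  have hne : -(rho : ℂ) + 1 ≠ 0 := by
    intro h
    have := congrArg Complex.re h
    simp only [Complex.add_re, Complex.neg_re, Complex.one_re, Complex.zero_re] at this
    change -(1 / 2 : ℝ) + 1 = 0 at this
    norm_num at this
  rw [gen₁, mk_smul]
  ext
  rw [coe_specialLinearGroup_apply]
  simp only [mat₁, Matrix.of_apply, Matrix.cons_val', Matrix.cons_val_zero, Matrix.cons_val_one,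
    Matrix.cons_val_fin_one, map_zero, map_one, map_neg, Complex.ofReal_zero, Complex.ofReal_one,
    Complex.ofReal_neg, zero_mul, zero_add, neg_mul, one_mul]
  rw [div_eq_iff hne]
  apply Complex.ext
  · simp only [Complex.mul_re, Complex.add_re, Complex.neg_re, Complex.one_re, Complex.add_im,
      Complex.neg_im, Complex.one_im]
    change (1 : ℝ) = 1 / 2 * (-(1 / 2) + 1) - √3 / 2 * (-(√3 / 2) + 0)
    nlinarith
  · simp only [Complex.mul_im, Complex.add_re, Complex.neg_re, Complex.one_re, Complex.add_im,
      Complex.neg_im, Complex.one_im]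
    change (0 : ℝ) = 1 / 2 * (-(√3 / 2) + 0) + √3 / 2 * (-(1 / 2) + 1)
    ring

lemma smul_eq_of_mem_zpowers {c : PSL(2, ℤ)} {z : ℍ} (hc : c • z = z) {a b : PSL(2, ℤ)}
    (h : QuotientGroup.leftRel (Subgroup.zpowers c) a b) : a • z = b • z := by
  have h1 : a⁻¹ * b ∈ Subgroup.zpowers c := QuotientGroup.leftRel_apply.mp h
  have h2 : Subgroup.zpowers c ≤ MulAction.stabilizer PSL(2, ℤ) z := by
    rw [Subgroup.zpowers_le]
    exact hc
  have h3 : (a⁻¹ * b) • z = z := h2 h1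
  rw [mul_smul, inv_smul_eq_iff] at h3
  exact h3.symm

/-- The `Γ`-equivariant isomorphism `f : T → 𝒯` that takes the vertex `G₀` to `i` and the vertex
`G₁` to `e^{πi/3}`: `g G₀ ↦ g i`, `g G₁ ↦ g e^{πi/3}`, and the edge `g` goes to `g • seg`. -/
def isoT : Hom T treeH where
  v₀ := Quotient.lift
    (fun g => (⟨g • (I : ℍ), MulAction.mem_orbit _ _⟩ : MulAction.orbit PSL(2, ℤ) (I : ℍ)))
    (fun _ _ h => Subtype.ext (smul_eq_of_mem_zpowers gen₀_smul_I h))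
  v₁ := Quotient.lift
    (fun g => (⟨g • rho, MulAction.mem_orbit _ _⟩ : MulAction.orbit PSL(2, ℤ) rho))
    (fun _ _ h => Subtype.ext (smul_eq_of_mem_zpowers gen₁_smul_rho h))
  e := edgeOf
  end₀_e g := Subtype.ext (pt₀_end₀_edgeOf g)
  end₁_e g := Subtype.ext (pt₁_end₁_edgeOf g)

/-- The subset of `ℍ` formed by the edges in the image of a graph morphism into `𝒯`. -/
def carrier {X : BiGraph} (h : Hom X treeH) : Set ℍ := ⋃ x, edgeSet (h.e x)

/-! ### The cyclic orientation of `𝒯` -/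

/-- The direction at `v` of the geodesic from `v` to `w`, up to a rotation that depends only on
`v`. The map `w ↦ (w - v) / (w - conj v)` is a holomorphic isometry onto the Poincaré disc that
takes `v` to the centre, hence takes the geodesics through `v` to straight lines through the
centre. -/
def direction (v w : ℍ) : Real.Angle :=
  (Complex.arg (((w : ℂ) - v) / ((w : ℂ) - (starRingEnd ℂ) (v : ℂ))) : ℝ)

/-- The edges `s`, `s'`, `s''` of `𝒯`, which meet in the vertex `v` of type (1), are met in this
order when one turns counterclockwise around `v`. -/
def CyclicallyOrdered (v : treeH.V₁) (s s' s'' : treeH.E) : Prop :=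
  sbtw (direction (pt₁ v) (pt₀ (treeH.end₀ s))) (direction (pt₁ v) (pt₀ (treeH.end₀ s')))
    (direction (pt₁ v) (pt₀ (treeH.end₀ s'')))

/-- `ι : X' → 𝒯` is an embedding of graphs that preserves the types of the vertices, takes the
extremities of the distinguished edge to `i` and `e^{πi/3}`, and preserves the cyclic orientation
at each trivalent vertex. -/
structure IsStandardEmbedding {G : Subgroup PSL(2, ℤ)} {C : Set (Xcomb G).V₀}
    (ι : Hom (cutGraph G C) treeH) : Prop where
  injective₀ : Function.Injective ι.v₀
  injective₁ : Function.Injective ι.v₁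
  injective_e : Function.Injective ι.e
  base₀ : pt₀ (ι.v₀ ((cutGraph G C).end₀ (distEdge G))) = I
  base₁ : pt₁ (ι.v₁ ((cutGraph G C).end₁ (distEdge G))) = rho
  cyclic : ∀ x : (cutGraph G C).E, (cutGraph G C).valency₁ ((cutGraph G C).end₁ x) = 3 →
    CyclicallyOrdered (ι.v₁ ((cutGraph G C).end₁ x))
      (ι.e x) (ι.e (nextEdge G x)) (ι.e (nextEdge G (nextEdge G x)))

/-! ### The retraction `p` and the polygon `P` -/

/-- `p` is a `Γ`-equivariant retraction of `ℍ` onto `𝒯` whose restriction to the triangle is a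
continuous retraction onto `seg` that takes precisely the imaginary half-axis to `i` and precisely
the two other sides to `e^{πi/3}`. -/
structure IsEquivariantRetraction (p : ℍ → ℍ) : Prop where
  equivariant : ∀ (g : PSL(2, ℤ)) (z : ℍ), p (g • z) = g • p z
  continuousOn : ContinuousOn p triangle
  mapsTo : ∀ z ∈ triangle, p z ∈ seg
  fixes : ∀ z ∈ seg, p z = z
  eq_I_iff : ∀ z ∈ triangle, p z = I ↔ z.re = 0
  eq_rho_iff : ∀ z ∈ triangle, p z = rho ↔ z.re = 1 / 2 ∨ ‖(z : ℂ) - 1‖ = 1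

/-- The polygon `P` given by a retraction `p` and a lift `j`: the preimage `p⁻¹(f(j(X')))`, freed
from the half-geodesics that may stick out of it, i.e. replaced by the closure of its interior. -/
def polygon {G : Subgroup PSL(2, ℤ)} {C : Set (Xcomb G).V₀} (p : ℍ → ℍ)
    (j : Hom (cutGraph G C) T) : Set ℍ :=
  closure (interior (p ⁻¹' carrier (isoT.comp j)))

/-- The union of the triangles `g • triangle` for all edges `g • seg` in the image of `ι`. -/
def unionOfTriangles {X : BiGraph} (ι : Hom X treeH) : Set ℍ :=
  ⋃ g ∈ {g : PSL(2, ℤ) | ∃ x, edgeSet (ι.e x) = g • seg}, g • triangle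

end ModularTree

end

open ModularTree

namespace ModularTree

/-! ### The group `PSL(2, ℤ)` -/

/-! An edge of `𝒯` is `g • seg` for exactly one `g` in `Γ` (`smul_seg_injective`), so a morphism
from `X'` to `T` or to `𝒯` amounts to a labelling `d` of the edges of `X'`, that is of the cosets,
by elements of `Γ`. Lifts and standard embeddings both turn out to be labellings of the same kind,
called developments: `d` commutes with right multiplication by `gen₀` and `gen₁` wherever `X'`
really joins two edges. For lifts (`IsLift.isDevelopment`) this follows by projecting to `G \ Γ`.
For embeddings (`IsStandardEmbedding.exists_isDevelopment`) it is the cyclic orientation that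
decides between `gen₁` and `gen₁⁻¹`, because `gen₁` rotates by `2π/3` around `rho`.

On a connected graph a development is determined up to a left factor by its value on one edge
(`IsDevelopment.eq_mul`). This gives the uniqueness of `ι` and shows that the labels of `j` are
those of `ι` multiplied by `baseElt j`. Developments exist because a cocycle on a tree has a
potential (`exists_isDevelopment`). The development with value `1` on the distinguished edge gives
an embedding; the delicate point is that the two edges at a cut vertex are not glued again. This
holds because the imaginary half-axis separates the tree at `I`, and the image can cross it only at
`I` itself (`IsDevelopment.apply_ne`).

The geometry enters through `p`. It maps `k • triangle` into `k • seg`, and distinct edges share at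
most an extremity (`cases_of_mem_seg_smul_mem_seg`), so in the open part of `k • triangle` the value
of `p` determines `k`. As the triangles are locally finite, the closure of the interior of the
preimage of a set of edges is the union of the corresponding triangles
(`closure_interior_preimage`). The preimage itself can exceed this union only along sides issuing
from copies of `rho`, and it does not if all three edges at every vertex of type (1) are present
(`preimage_eq_iUnion`). -/

lemma mk_neg (A : SL(2, ℤ)) : (QuotientGroup.mk (-A) : PSL(2, ℤ)) = QuotientGroup.mk A := by
  rw [QuotientGroup.eq, Matrix.SpecialLinearGroup.mem_center_iff]
  refine ⟨-1, by norm_num, ?_⟩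
  have h : (-A)⁻¹ * A = -1 := by rw [inv_neg]; simp
  rw [h]
  ext i j
  fin_cases i <;> fin_cases j <;> simp

lemma gen₀_mul_gen₀ : gen₀ * gen₀ = 1 := by
  have h : mat₀ * mat₀ = -1 := by decide
  rw [gen₀, ← QuotientGroup.mk_mul, h, mk_neg]
  rfl

lemma gen₁_mul_gen₁ : gen₁ * gen₁ = gen₁⁻¹ := by
  have h : mat₁ * mat₁ = -mat₁⁻¹ := by decide
  rw [gen₁, ← QuotientGroup.mk_mul, h, mk_neg]
  rfl

lemma gen₀_inv : gen₀⁻¹ = gen₀ := inv_eq_of_mul_eq_one_left gen₀_mul_gen₀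

lemma mem_G₀_iff {g : PSL(2, ℤ)} : g ∈ G₀ ↔ g = 1 ∨ g = gen₀ := by
  refine ⟨fun h => ?_, ?_⟩
  · obtain ⟨n, rfl⟩ := h
    beta_reduce
    induction n using Int.induction_on with
    | zero => simp
    | succ n ih => rw [zpow_add_one]; rcases ih with h | h <;> simp [h, gen₀_mul_gen₀]
    | pred n ih => rw [zpow_sub_one]; rcases ih with h | h <;> simp [h, gen₀_inv, gen₀_mul_gen₀]
  · rintro (rfl | rfl)
    · exact one_mem _
    · exact Subgroup.mem_zpowers _

lemma mem_G₁_iff {g : PSL(2, ℤ)} : g ∈ G₁ ↔ g = 1 ∨ g = gen₁ ∨ g = gen₁⁻¹ := by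
  have h2 : gen₁⁻¹ * gen₁⁻¹ = gen₁ := by rw [← mul_inv_rev, gen₁_mul_gen₁, inv_inv]
  refine ⟨fun h => ?_, ?_⟩
  · obtain ⟨n, rfl⟩ := h
    beta_reduce
    induction n using Int.induction_on with
    | zero => simp
    | succ n ih => rw [zpow_add_one]; rcases ih with h | h | h <;> simp [h, gen₁_mul_gen₁]
    | pred n ih => rw [zpow_sub_one]; rcases ih with h | h | h <;> simp [h, h2]
  · rintro (rfl | rfl | rfl)
    · exact one_mem _
    · exact Subgroup.mem_zpowers _
    · exact inv_mem (Subgroup.mem_zpowers _)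

/-! ### Coordinates on the upper half-plane -/

lemma norm_sq_eq (z : ℍ) : ‖(z : ℂ)‖ ^ 2 = z.re ^ 2 + z.im ^ 2 := by
  rw [← Complex.normSq_eq_norm_sq, Complex.normSq_apply, coe_re, coe_im]
  ring

lemma norm_sub_one_sq_eq (z : ℍ) : ‖(z : ℂ) - 1‖ ^ 2 = (z.re - 1) ^ 2 + z.im ^ 2 := by
  rw [← Complex.normSq_eq_norm_sq, Complex.normSq_apply]
  simp
  ring

lemma normSq_pos (z : ℍ) : 0 < z.re ^ 2 + z.im ^ 2 := by
  have := z.im_pos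
  positivity

lemma mem_seg_iff {z : ℍ} : z ∈ seg ↔ z.re ^ 2 + z.im ^ 2 = 1 ∧ 0 ≤ z.re ∧ z.re ≤ 1 / 2 := by
  rw [← norm_sq_eq]
  have h0 := norm_nonneg (z : ℂ)
  refine and_congr_left fun _ => ⟨fun h => by rw [h]; norm_num, fun h => by nlinarith⟩

lemma norm_sub_one_eq_one_iff {z : ℍ} :
    ‖(z : ℂ) - 1‖ = 1 ↔ z.re ^ 2 + z.im ^ 2 = 2 * z.re := by
  have h := norm_sub_one_sq_eq z
  have h0 := norm_nonneg ((z : ℂ) - 1)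
  refine ⟨fun h1 => by rw [h1] at h; linarith, fun h1 => by nlinarith⟩

lemma mem_triangle_iff {z : ℍ} :
    z ∈ triangle ↔ 0 ≤ z.re ∧ z.re ≤ 1 / 2 ∧ 2 * z.re ≤ z.re ^ 2 + z.im ^ 2 := by
  have h := norm_sub_one_sq_eq z
  have h0 := norm_nonneg ((z : ℂ) - 1)
  refine and_congr_right fun _ => and_congr_right fun _ =>
    ⟨fun h1 => by nlinarith, fun h1 => by nlinarith⟩

lemma eq_I_of_mem_seg {z : ℍ} (hz : z ∈ seg) (h : z.re = 0) : z = I := by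
  have h1 := (mem_seg_iff.mp hz).1
  have h2 := z.im_pos
  refine UpperHalfPlane.ext (Complex.ext (by simpa using h) ?_)
  simp
  nlinarith

lemma rho_re : rho.re = 1 / 2 := rfl

lemma rho_im : rho.im = √3 / 2 := rfl

lemma rho_ne_I : rho ≠ I := by
  intro h
  have := congrArg UpperHalfPlane.re h
  norm_num [rho_re] at this

lemma gen₀_smul_coe (z : ℍ) : ((gen₀ • z : ℍ) : ℂ) = -1 / z := by
  rw [gen₀, mk_smul, coe_specialLinearGroup_apply]
  simp [mat₀]

lemma gen₁_smul_coe (z : ℍ) : ((gen₁ • z : ℍ) : ℂ) = 1 / (1 - z) := by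
  rw [gen₁, mk_smul, coe_specialLinearGroup_apply]
  simp [mat₁, sub_eq_neg_add]

lemma mat₁_inv : mat₁⁻¹ = ⟨!![1, -1; 1, 0], by norm_num [Matrix.det_fin_two_of]⟩ := Subtype.ext (by decide)

lemma gen₁_inv_smul_coe (z : ℍ) : ((gen₁⁻¹ • z : ℍ) : ℂ) = 1 - 1 / z := by
  have hz : (z : ℂ) ≠ 0 := z.ne_zero
  have h : (gen₁⁻¹ : PSL(2, ℤ)) = QuotientGroup.mk (mat₁⁻¹) := rfl
  rw [h, mk_smul, coe_specialLinearGroup_apply]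
  simp [mat₁_inv]
  field_simp
  ring

lemma gen₀_smul_re (z : ℍ) : (gen₀ • z).re = -z.re / (z.re ^ 2 + z.im ^ 2) := by
  rw [← coe_re, gen₀_smul_coe, Complex.div_re, Complex.normSq_apply]
  simp [pow_two]

lemma gen₀_smul_im (z : ℍ) : (gen₀ • z).im = z.im / (z.re ^ 2 + z.im ^ 2) := by
  rw [← coe_im, gen₀_smul_coe, Complex.div_im, Complex.normSq_apply]
  simp [pow_two, neg_div]

lemma gen₁_smul_re (z : ℍ) : (gen₁ • z).re = (1 - z.re) / ((1 - z.re) ^ 2 + z.im ^ 2) := by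
  rw [← coe_re, gen₁_smul_coe, Complex.div_re, Complex.normSq_apply]
  simp [pow_two]

lemma gen₁_smul_im (z : ℍ) : (gen₁ • z).im = z.im / ((1 - z.re) ^ 2 + z.im ^ 2) := by
  rw [← coe_im, gen₁_smul_coe, Complex.div_im, Complex.normSq_apply]
  simp [pow_two, neg_div]

lemma gen₁_inv_smul_re (z : ℍ) :
    (gen₁⁻¹ • z).re = 1 - z.re / (z.re ^ 2 + z.im ^ 2) := by
  rw [← coe_re, gen₁_inv_smul_coe, Complex.sub_re, Complex.div_re, Complex.normSq_apply]
  simp [pow_two]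

lemma gen₁_inv_smul_im (z : ℍ) : (gen₁⁻¹ • z).im = z.im / (z.re ^ 2 + z.im ^ 2) := by
  rw [← coe_im, gen₁_inv_smul_coe, Complex.sub_im, Complex.div_im, Complex.normSq_apply]
  simp [pow_two]

/-! ### Intersections of the copies of `seg` -/

lemma vadd_ρ_eq_rho : (1 : ℝ) +ᵥ UpperHalfPlane.ρ = rho := by
  refine UpperHalfPlane.ext (Complex.ext ?_ ?_)
  · rw [coe_re, coe_re, vadd_re, rho_re]
    norm_num [UpperHalfPlane.ρ, UpperHalfPlane.re]
  · rw [coe_im, coe_im, vadd_im, rho_im]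
    norm_num [UpperHalfPlane.ρ, UpperHalfPlane.im]

lemma seg_subset_fd : seg ⊆ ModularGroup.fd := by
  intro z hz
  obtain ⟨h1, h2, h3⟩ := hz
  refine ⟨?_, ?_⟩
  · rw [Complex.normSq_eq_norm_sq, h1]; norm_num
  · rw [abs_of_nonneg h2]; exact h3

/-- A copy of `seg` meets `seg` only in a common extremity, unless it is `seg` itself. -/
lemma cases_of_mem_seg_smul_mem_seg {k : PSL(2, ℤ)} {z : ℍ} (hz : z ∈ seg) (hk : k • z ∈ seg) :
    k = 1 ∨ (k = gen₀ ∧ z = I) ∨ ((k = gen₁ ∨ k = gen₁⁻¹) ∧ z = rho) := by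
  induction k using QuotientGroup.induction_on with | H A =>
  rw [mk_smul] at hk
  have hs : ModularGroup.S = mat₀ := by decide
  have hst : ModularGroup.S * ModularGroup.T⁻¹ = -mat₁ := by decide
  have hts : ModularGroup.T * ModularGroup.S = mat₁⁻¹ := by decide
  have hρ : UpperHalfPlane.ρ.re = -1 / 2 := rfl
  have hpm : ∀ {B : SL(2, ℤ)}, A = B ∨ A = -B →
      (QuotientGroup.mk A : PSL(2, ℤ)) = QuotientGroup.mk B := by
    rintro B (rfl | rfl)
    · rfl
    · exact mk_neg B
  have hpm' : ∀ {B : SL(2, ℤ)}, A = B ∨ A = -B → A • z = B • z := by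
    rintro B (rfl | rfl)
    · rfl
    · exact ModularGroup.SL_neg_smul B z
  have hz1 := mem_seg_iff.mp hz
  have hk1 := mem_seg_iff.mp hk
  -- `seg` is the right half of the circular side of the fundamental domain, and Mathlib's corner
  -- `ρ` has real part `-1/2`, so that `rho` is `ρ + 1`. Every case that puts `z` or its image on
  -- the line `Re = -1/2` is excluded.
  rcases ModularGroup.cases_of_mem_fd_smul_mem_fd (seg_subset_fd hz) (seg_subset_fd hk) with
    h | ⟨-, h⟩ | ⟨h, h'⟩ | ⟨h, h'⟩ | ⟨h, h'⟩ | ⟨h, h'⟩ | ⟨h, h'⟩ | ⟨-, h⟩ | ⟨-, h⟩ | ⟨-, h⟩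
  · exact Or.inl (hpm h)
  · linarith [hz1.2.1]
  · rw [hpm' h, ModularGroup.re_T_inv_smul, h'] at hk1
    linarith [hk1.2.1]
  · rw [hs] at h
    refine Or.inr (Or.inl ⟨hpm h, eq_I_of_mem_seg hz ?_⟩)
    have h2 := gen₀_smul_re z
    rw [hpm' h, ← mk_smul, ← gen₀, h2, hz1.1] at hk1
    linarith [hk1.2.1, hz1.2.1]
  · rw [vadd_ρ_eq_rho] at h'
    rw [hts] at h
    exact Or.inr (Or.inr ⟨Or.inr (hpm h), h'⟩)
  · rw [mul_assoc, hst, mul_neg, neg_neg, or_comm] at h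
    rw [hpm' h, mul_smul, ModularGroup.re_T_inv_smul, ← mk_smul mat₁, ← gen₁, h', vadd_ρ_eq_rho,
      gen₁_smul_rho, rho_re] at hk1
    linarith [hk1.2.1]
  · rw [vadd_ρ_eq_rho] at h'
    rw [hst, neg_neg, or_comm] at h
    exact Or.inr (Or.inr ⟨Or.inl (hpm h), h'⟩)
  all_goals
    rw [h, hρ] at hz1
    linarith [hz1.2.1]

lemma gen₁_inv_smul_rho : gen₁⁻¹ • rho = rho := by rw [inv_smul_eq_iff, gen₁_smul_rho]

lemma smul_I_eq_I_iff {k : PSL(2, ℤ)} : k • (I : ℍ) = I ↔ k ∈ G₀ := by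
  rw [mem_G₀_iff]
  constructor
  · intro h
    rcases cases_of_mem_seg_smul_mem_seg I_mem_seg (h.symm ▸ I_mem_seg) with h | ⟨h, -⟩ | ⟨-, h⟩
    · exact Or.inl h
    · exact Or.inr h
    · exact absurd h.symm rho_ne_I
  · rintro (rfl | rfl)
    · exact one_smul _ _
    · exact gen₀_smul_I

lemma smul_rho_eq_rho_iff {k : PSL(2, ℤ)} : k • rho = rho ↔ k ∈ G₁ := by
  rw [mem_G₁_iff]
  constructor
  · intro h
    rcases cases_of_mem_seg_smul_mem_seg rho_mem_seg (h.symm ▸ rho_mem_seg) with h | ⟨-, h⟩ | ⟨h, -⟩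
    · exact Or.inl h
    · exact absurd h rho_ne_I
    · exact Or.inr h
  · rintro (rfl | rfl | rfl)
    · exact one_smul _ _
    · exact gen₁_smul_rho
    · exact gen₁_inv_smul_rho

lemma smul_I_eq_smul_I_iff {g h : PSL(2, ℤ)} :
    g • (I : ℍ) = h • (I : ℍ) ↔ h = g ∨ h = g * gen₀ := by
  rw [eq_comm, ← inv_smul_eq_iff, ← mul_smul, smul_I_eq_I_iff, mem_G₀_iff, inv_mul_eq_one,
    inv_mul_eq_iff_eq_mul, eq_comm]

lemma smul_rho_eq_smul_rho_iff {g h : PSL(2, ℤ)} :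
    g • rho = h • rho ↔ h = g ∨ h = g * gen₁ ∨ h = g * gen₁⁻¹ := by
  rw [eq_comm, ← inv_smul_eq_iff, ← mul_smul, smul_rho_eq_rho_iff, mem_G₁_iff, inv_mul_eq_one,
    inv_mul_eq_iff_eq_mul, inv_mul_eq_iff_eq_mul, eq_comm]

/-- The stabilizers of `rho` and `I` have orders 3 and 2. By the classification only `gen₀` has to
be excluded, and it moves `rho` to the left of the imaginary half-axis. -/
lemma eq_one_of_smul_eq {k : PSL(2, ℤ)} (h0 : k • (I : ℍ) = I) (h1 : k • rho = rho) : k = 1 := by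
  rcases cases_of_mem_seg_smul_mem_seg rho_mem_seg (h1.symm ▸ rho_mem_seg) with h | ⟨-, h⟩ | ⟨h, -⟩
  · exact h
  · exact absurd h rho_ne_I
  · rcases cases_of_mem_seg_smul_mem_seg I_mem_seg (h0.symm ▸ I_mem_seg) with h' | ⟨h', -⟩ | ⟨-, h'⟩
    · exact h'
    · have h2 : gen₀ • rho = rho := h' ▸ h1
      have := gen₀_smul_re rho
      rw [h2, rho_re] at this
      have h3 := normSq_pos rho
      rw [rho_re] at h3
      have : (0 : ℝ) < 0 := by
        calc (0 : ℝ) < 1 / 2 := by norm_num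
          _ = _ := this
          _ ≤ 0 := by rw [neg_div, neg_nonpos]; positivity
      exact absurd this (lt_irrefl _)
    · exact absurd h'.symm rho_ne_I

lemma exists_eq_edgeOf (s : treeH.E) : ∃ g, s = edgeOf g := by
  obtain ⟨_, g, rfl⟩ := s
  exact ⟨g, rfl⟩

/-- A copy of `seg` contains one point of each of the two vertex orbits, so as a set it determines
`g • I` and `g • rho`, and these determine `g`. -/
lemma smul_seg_injective : Function.Injective fun g : PSL(2, ℤ) => g • seg := by
  intro g h hgh
  change g • seg = h • seg at hgh
  have hI := (existsUnique_mem I_mem_seg (fun _ => smul_I_mem_seg) h (g • I)).mp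
    ⟨MulAction.mem_orbit _ _, hgh ▸ Set.smul_mem_smul_set I_mem_seg⟩
  have hρ := (existsUnique_mem rho_mem_seg (fun _ => smul_rho_mem_seg) h (g • rho)).mp
    ⟨MulAction.mem_orbit _ _, hgh ▸ Set.smul_mem_smul_set rho_mem_seg⟩
  have := eq_one_of_smul_eq (k := h⁻¹ * g) (by rw [mul_smul, hI, inv_smul_smul])
    (by rw [mul_smul, hρ, inv_smul_smul])
  exact (inv_mul_eq_one.mp this).symm

lemma edgeOf_injective : Function.Injective edgeOf := fun _ _ h =>
  smul_seg_injective (congrArg edgeSet h)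

/-! ### The copies of the triangle -/

instance : ContinuousConstSMul PSL(2, ℤ) ℍ where
  continuous_const_smul g := by
    induction g using QuotientGroup.induction_on with | H A =>
    exact continuous_const_smul (Matrix.SpecialLinearGroup.mapGL ℝ A)

/-- The right half of the standard fundamental domain lies in `triangle`, and `gen₀` moves the left
half into it. -/
lemma exists_mem_smul_triangle (z : ℍ) : ∃ k : PSL(2, ℤ), z ∈ k • triangle := by
  obtain ⟨A, h1, h2⟩ := ModularGroup.exists_smul_mem_fd z
  set w := A • z with hw
  have hz : z = (QuotientGroup.mk A : PSL(2, ℤ))⁻¹ • w := by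
    rw [eq_inv_smul_iff, mk_smul]
  rw [Complex.normSq_eq_norm_sq, norm_sq_eq] at h1
  rw [abs_le] at h2
  by_cases h0 : 0 ≤ w.re
  · refine ⟨(QuotientGroup.mk A)⁻¹, hz ▸ Set.smul_mem_smul_set ?_⟩
    exact mem_triangle_iff.mpr ⟨h0, h2.2, by linarith⟩
  · refine ⟨(QuotientGroup.mk A)⁻¹ * gen₀, ?_⟩
    rw [hz, mul_smul, Set.smul_mem_smul_set_iff, Set.mem_smul_set_iff_inv_smul_mem, gen₀_inv,
      mem_triangle_iff, gen₀_smul_re, gen₀_smul_im]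
    push Not at h0
    have hq := normSq_pos w
    set q := w.re ^ 2 + w.im ^ 2 with hqd
    have h3 : (-w.re / q) ^ 2 + (w.im / q) ^ 2 = 1 / q := by
      field_simp
      rw [hqd]
    rw [h3]
    refine ⟨div_nonneg (by linarith) hq.le, ?_, ?_⟩
    · rw [div_le_iff₀ hq]; linarith
    · rw [mul_div_assoc', div_le_div_iff_of_pos_right hq]; linarith

lemma isClosed_triangle : IsClosed triangle := by
  have h : triangle = {z : ℍ | 0 ≤ z.re} ∩ ({z : ℍ | z.re ≤ 1 / 2} ∩
      {z : ℍ | 2 * z.re ≤ z.re ^ 2 + z.im ^ 2}) := by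
    ext z
    exact mem_triangle_iff
  rw [h]
  have hre := continuous_re
  have him := continuous_im
  exact (isClosed_le (by fun_prop) (by fun_prop)).inter
    ((isClosed_le (by fun_prop) (by fun_prop)).inter (isClosed_le (by fun_prop) (by fun_prop)))

/-- The triangle without its sides. -/
def openTriangle : Set ℍ := {z | 0 < z.re ∧ z.re < 1 / 2 ∧ 2 * z.re < z.re ^ 2 + z.im ^ 2}

lemma isOpen_openTriangle : IsOpen openTriangle := by
  have h : openTriangle = {z : ℍ | 0 < z.re} ∩ ({z : ℍ | z.re < 1 / 2} ∩
      {z : ℍ | 2 * z.re < z.re ^ 2 + z.im ^ 2}) := rfl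
  rw [h]
  have hre := continuous_re
  have him := continuous_im
  exact (isOpen_lt (by fun_prop) (by fun_prop)).inter
    ((isOpen_lt (by fun_prop) (by fun_prop)).inter (isOpen_lt (by fun_prop) (by fun_prop)))

lemma openTriangle_subset_triangle : openTriangle ⊆ triangle := fun _ hz =>
  mem_triangle_iff.mpr ⟨hz.1.le, hz.2.1.le, hz.2.2.le⟩

lemma triangle_subset_closure_openTriangle : triangle ⊆ closure openTriangle := by
  intro z hz
  obtain ⟨h0, h1, h2⟩ := mem_triangle_iff.mp hz
  have him := z.im_pos
  -- The path moves towards the line `Re = 1/4` and upwards. The increment `t / z.im` raises `im ^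
  -- 2` by at least `2 * t`, which outweighs the loss of at most `t` in `(re - 1) ^ 2`.
  let c : ℝ → ℂ := fun t => ⟨z.re + t * (1 / 4 - z.re), z.im + t / z.im⟩
  have hc : Continuous c := by
    have : c = fun t => ((z.re + t * (1 / 4 - z.re) : ℝ) : ℂ) +
        ((z.im + t / z.im : ℝ) : ℂ) * Complex.I := by
      funext t
      apply Complex.ext <;> simp [c]
    rw [this]
    fun_prop
  have hc0 : c 0 = z := by apply Complex.ext <;> simp [c]
  rw [mem_closure_iff_nhds]
  intro s hs
  have hs' : UpperHalfPlane.coe '' s ∈ nhds (c 0) := by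
    rw [hc0]
    exact isOpenEmbedding_coe.isOpenMap.image_mem_nhds hs
  have hev : ∀ᶠ t in nhdsWithin (0 : ℝ) (Set.Ioi 0), c t ∈ UpperHalfPlane.coe '' s :=
    nhdsWithin_le_nhds (hc.continuousAt.preimage_mem_nhds hs')
  have hlt : ∀ᶠ t in nhdsWithin (0 : ℝ) (Set.Ioi 0), t < 1 :=
    nhdsWithin_le_nhds (Iio_mem_nhds zero_lt_one)
  obtain ⟨t, ⟨w, hw, hwt⟩, ht1, ht0⟩ := (hev.and (hlt.and self_mem_nhdsWithin)).exists
  replace ht0 : 0 < t := ht0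
  have hre : w.re = z.re + t * (1 / 4 - z.re) := by rw [← coe_re, hwt]
  have hwim : w.im = z.im + t / z.im := by rw [← coe_im, hwt]
  refine ⟨w, hw, ?_, ?_, ?_⟩
  · rw [hre]; nlinarith
  · rw [hre]; nlinarith
  · have h3 : z.im * (t / z.im) = t := by field_simp
    have h4 : w.im ^ 2 ≥ z.im ^ 2 + 2 * t := by
      rw [hwim]
      nlinarith [sq_nonneg (t / z.im)]
    have h5 : (w.re - 1) ^ 2 ≥ (z.re - 1) ^ 2 - t := by
      rw [hre]
      nlinarith [sq_nonneg (t * (1 / 4 - z.re)), mul_nonneg ht0.le h0,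
        mul_nonneg ht0.le (sub_nonneg.mpr h1)]
    nlinarith

/-- An open set that contains the triangle and is covered by the triangle and its neighbours. -/
lemma exists_isOpen_triangle_subset : ∃ O : Set ℍ, IsOpen O ∧ triangle ⊆ O ∧
    ∀ z ∈ O, ∃ k ∈ ({1, gen₀, gen₁, gen₁⁻¹} : Set PSL(2, ℤ)), z ∈ k • triangle := by
  have hre := continuous_re
  have him := continuous_im
  -- The boundary consists of outer sides of the four triangles: `Re = -1/2` and `|z + 1| = 1` bound
  -- `gen₀ • triangle`, while `Re = 1` and `|z - 1/2| = 1/2` are the images of the imaginary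
  -- half-axis under `gen₁⁻¹` and `gen₁`.
  refine ⟨{z | -1 / 2 < z.re} ∩ {z | z.re < 1} ∩ {z | 0 < z.re ^ 2 + z.im ^ 2 + 2 * z.re} ∩
    {z | z.re < z.re ^ 2 + z.im ^ 2}, ?_, ?_, ?_⟩
  · exact (((isOpen_lt (by fun_prop) (by fun_prop)).inter
      (isOpen_lt (by fun_prop) (by fun_prop))).inter
      (isOpen_lt (by fun_prop) (by fun_prop))).inter (isOpen_lt (by fun_prop) (by fun_prop))
  · intro z hz
    obtain ⟨h0, h1, h2⟩ := mem_triangle_iff.mp hz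
    have := normSq_pos z
    refine ⟨⟨⟨?_, ?_⟩, ?_⟩, ?_⟩ <;> simp only [Set.mem_ofPred_eq] <;> linarith
  · rintro z ⟨⟨⟨h1, h2⟩, h3⟩, h4⟩
    simp only [Set.mem_ofPred_eq] at h1 h2 h3 h4
    have hq := normSq_pos z
    by_cases h0 : z.re < 0
    · refine ⟨gen₀, by simp, ?_⟩
      rw [Set.mem_smul_set_iff_inv_smul_mem, gen₀_inv, mem_triangle_iff, gen₀_smul_re,
        gen₀_smul_im]
      set q := z.re ^ 2 + z.im ^ 2 with hqd
      have h5 : (-z.re / q) ^ 2 + (z.im / q) ^ 2 = 1 / q := by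
        field_simp
        rw [hqd]
      rw [h5]
      refine ⟨div_nonneg (by linarith) hq.le, ?_, ?_⟩
      · rw [div_le_iff₀ hq]; linarith
      · rw [mul_div_assoc', div_le_div_iff_of_pos_right hq]; linarith
    push Not at h0
    -- What remains is the ideal triangle with vertices `0`, `1`, `∞`, which the sides issuing from
    -- `rho` divide into three parts permuted by `gen₁`.
    by_cases h5 : z.re ≤ 1 / 2 ∧ 2 * z.re ≤ z.re ^ 2 + z.im ^ 2
    · exact ⟨1, by simp, by rw [one_smul]; exact mem_triangle_iff.mpr ⟨h0, h5⟩⟩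
    by_cases h6 : 1 / 2 ≤ z.re ∧ 1 ≤ z.re ^ 2 + z.im ^ 2
    · refine ⟨gen₁⁻¹, by simp, ?_⟩
      rw [Set.mem_smul_set_iff_inv_smul_mem, inv_inv, mem_triangle_iff, gen₁_smul_re,
        gen₁_smul_im]
      have hm : 0 < (1 - z.re) ^ 2 + z.im ^ 2 := by
        have := z.im_pos
        positivity
      set m := (1 - z.re) ^ 2 + z.im ^ 2 with hmd
      have h7 : ((1 - z.re) / m) ^ 2 + (z.im / m) ^ 2 = 1 / m := by
        field_simp
        rw [hmd]
      rw [h7]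
      refine ⟨div_nonneg (by linarith) hm.le, ?_, ?_⟩
      · rw [div_le_iff₀ hm]; nlinarith
      · rw [mul_div_assoc', div_le_div_iff_of_pos_right hm]; linarith
    · refine ⟨gen₁, by simp, ?_⟩
      have h8 : z.re ^ 2 + z.im ^ 2 ≤ 2 * z.re ∧ z.re ^ 2 + z.im ^ 2 ≤ 1 := by
        rw [not_and_or, not_le, not_le] at h5 h6
        rcases h5 with h5 | h5 <;> rcases h6 with h6 | h6 <;> constructor <;> linarith
      rw [Set.mem_smul_set_iff_inv_smul_mem, mem_triangle_iff, gen₁_inv_smul_re, gen₁_inv_smul_im]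
      set q := z.re ^ 2 + z.im ^ 2 with hqd
      have h9 : (1 - z.re / q) ^ 2 + (z.im / q) ^ 2 = 1 - 2 * (z.re / q) + 1 / q := by
        field_simp
        rw [hqd]; ring
      rw [h9]
      have h10 : z.re / q ≤ 1 := by rw [div_le_one hq]; exact h4.le
      have h11 : 1 / 2 ≤ z.re / q := by rw [le_div_iff₀ hq]; linarith
      have h12 : 1 ≤ 1 / q := by rw [le_div_iff₀ hq]; linarith
      refine ⟨?_, ?_, ?_⟩ <;> linarith

/-! ### Preimages under an equivariant retraction -/

section

variable {p : ℍ → ℍ} (hp : IsEquivariantRetraction p)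
include hp

lemma IsEquivariantRetraction.apply_mem_smul_seg {k : PSL(2, ℤ)} {z : ℍ}
    (hz : z ∈ k • triangle) : p z ∈ k • seg := by
  obtain ⟨w, hw, rfl⟩ := hz
  change p (k • w) ∈ _
  rw [hp.equivariant]
  exact Set.smul_mem_smul_set (hp.mapsTo w hw)

/-- `p z` lies on both edges `k • seg` and `g • seg`, so the edges coincide or `p z` is their common
extremity. -/
lemma IsEquivariantRetraction.cases_of_apply_mem {g k : PSL(2, ℤ)} {z : ℍ}
    (hz : z ∈ k • triangle) (hg : p z ∈ g • seg) :
    g = k ∨ (g = k * gen₀ ∧ p (k⁻¹ • z) = I) ∨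
      ((g = k * gen₁ ∨ g = k * gen₁⁻¹) ∧ p (k⁻¹ • z) = rho) := by
  have h1 : p (k⁻¹ • z) ∈ seg :=
    hp.mapsTo _ (Set.mem_smul_set_iff_inv_smul_mem.mp hz)
  have h2 : (g⁻¹ * k) • p (k⁻¹ • z) ∈ seg := by
    rw [mul_smul, hp.equivariant, smul_inv_smul]
    exact Set.mem_smul_set_iff_inv_smul_mem.mp hg
  have h3 : g = k * (g⁻¹ * k)⁻¹ := by group
  rcases cases_of_mem_seg_smul_mem_seg h1 h2 with h | ⟨h, h'⟩ | ⟨h | h, h'⟩ <;> rw [h] at h3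
  · exact Or.inl (by simpa using h3)
  · exact Or.inr (Or.inl ⟨by rwa [gen₀_inv] at h3, h'⟩)
  · exact Or.inr (Or.inr ⟨Or.inr h3, h'⟩)
  · exact Or.inr (Or.inr ⟨Or.inl (by rwa [inv_inv] at h3), h'⟩)

/-- The retraction gives a combinatorial proof: if `g • triangle` and `k • triangle` share a point,
its image lies on both edges, so `k⁻¹ * g` is one of four elements. A neighbourhood covered by four
triangles therefore meets only triangles with labels in `k • (F * F)`. -/
lemma IsEquivariantRetraction.locallyFinite :
    LocallyFinite fun k : PSL(2, ℤ) => k • triangle := by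
  intro z
  obtain ⟨k, hk⟩ := exists_mem_smul_triangle z
  obtain ⟨O, hO, hsub, hcov⟩ := exists_isOpen_triangle_subset
  refine ⟨k • O, (hO.smul k).mem_nhds (Set.smul_set_mono hsub hk), ?_⟩
  let F : Set PSL(2, ℤ) := {1, gen₀, gen₁, gen₁⁻¹}
  have hF : F.Finite := by simp [F]
  refine ((hF.mul hF).smul_set (a := k)).subset ?_
  rintro g ⟨w, hgw, hw⟩
  obtain ⟨a, ha, haw⟩ := hcov _ (Set.mem_smul_set_iff_inv_smul_mem.mp hw)
  have hka : w ∈ (k * a) • triangle := by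
    rw [mul_smul]
    exact Set.mem_smul_set_iff_inv_smul_mem.mpr haw
  have hb : ∃ b ∈ F, g = (k * a) * b := by
    rcases hp.cases_of_apply_mem hka (hp.apply_mem_smul_seg hgw) with h | ⟨h, -⟩ | ⟨h | h, -⟩
    · exact ⟨1, by simp [F], by simpa using h⟩
    · exact ⟨gen₀, by simp [F], h⟩
    · exact ⟨gen₁, by simp [F], h⟩
    · exact ⟨gen₁⁻¹, by simp [F], h⟩
  obtain ⟨b, hb, rfl⟩ := hb
  exact ⟨a * b, Set.mul_mem_mul ha hb, (mul_assoc k a b).symm⟩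

lemma IsEquivariantRetraction.isClosed_iUnion (A : Set PSL(2, ℤ)) :
    IsClosed (⋃ k ∈ A, k • triangle) := by
  rw [Set.biUnion_eq_iUnion]
  exact (hp.locallyFinite.comp_injective Subtype.val_injective).isClosed_iUnion
    fun k => isClosed_triangle.smul (k : PSL(2, ℤ))

lemma IsEquivariantRetraction.iUnion_subset_preimage (A : Set PSL(2, ℤ)) :
    (⋃ k ∈ A, k • triangle) ⊆ p ⁻¹' ⋃ k ∈ A, k • seg := by
  intro z hz
  obtain ⟨k, hk, hz⟩ := Set.mem_iUnion₂.mp hz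
  exact Set.mem_iUnion₂.mpr ⟨k, hk, hp.apply_mem_smul_seg hz⟩

/-- The preimage of a union of edges, freed from the sticking out half-geodesics, is the union of
the corresponding triangles. -/
lemma IsEquivariantRetraction.closure_interior_preimage (A : Set PSL(2, ℤ)) :
    closure (interior (p ⁻¹' ⋃ k ∈ A, k • seg)) = ⋃ k ∈ A, k • triangle := by
  apply subset_antisymm
  · refine (hp.isClosed_iUnion A).closure_subset_iff.mpr fun z hz => ?_
    obtain ⟨k, hk⟩ := exists_mem_smul_triangle z
    -- Near `z` there is a point `w` of the open part of `k • triangle` that still lies in the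
    -- preimage. Since `p w` is no vertex, the edge of `A` that contains it must be `k • seg`.
    have hz' : z ∈ closure (k • openTriangle) := by
      rw [closure_smul]
      exact Set.smul_set_mono triangle_subset_closure_openTriangle hk
    obtain ⟨w, hwi, hwk⟩ := mem_closure_iff_nhds.mp hz' _ (isOpen_interior.mem_nhds hz)
    have hwp : w ∈ p ⁻¹' ⋃ k ∈ A, k • seg := interior_subset hwi
    obtain ⟨g, hg, hwg⟩ := Set.mem_iUnion₂.mp hwp
    have hw0 := Set.mem_smul_set_iff_inv_smul_mem.mp hwk
    have hw1 := openTriangle_subset_triangle hw0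
    refine Set.mem_iUnion₂.mpr ⟨k, ?_, hk⟩
    rcases hp.cases_of_apply_mem (Set.mem_smul_set_iff_inv_smul_mem.mpr hw1) hwg with
      h | ⟨-, h⟩ | ⟨-, h⟩
    · exact h ▸ hg
    · rw [hp.eq_I_iff _ hw1] at h
      exact absurd h hw0.1.ne'
    · rw [hp.eq_rho_iff _ hw1, norm_sub_one_eq_one_iff] at h
      rcases h with h | h
      · exact absurd h hw0.2.1.ne
      · exact absurd h hw0.2.2.ne'
  · refine Set.iUnion₂_subset fun k hk => ?_
    have h1 : k • openTriangle ⊆ interior (p ⁻¹' ⋃ k ∈ A, k • seg) := by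
      refine interior_maximal ?_ (isOpen_openTriangle.smul k)
      refine subset_trans ?_ (hp.iUnion_subset_preimage A)
      exact (Set.smul_set_mono openTriangle_subset_triangle).trans
        (Set.subset_biUnion_of_mem (u := fun k => k • triangle) hk)
    refine subset_trans ?_ (closure_mono h1)
    rw [closure_smul]
    exact Set.smul_set_mono triangle_subset_closure_openTriangle

/-- A point sent to a vertex of type (0) lies on the side common to `k • triangle` and `(k * gen₀) •
triangle`, so it is covered in any case. A point sent to a vertex of type (1) may lie in only some
of the triangles around this vertex; stability under `gen₁` puts all three into the union. -/
lemma IsEquivariantRetraction.preimage_eq_iUnion {A : Set PSL(2, ℤ)}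
    (hA : ∀ k ∈ A, k * gen₁ ∈ A) : p ⁻¹' (⋃ k ∈ A, k • seg) = ⋃ k ∈ A, k • triangle := by
  refine subset_antisymm (fun z hz => ?_) (hp.iUnion_subset_preimage A)
  obtain ⟨g, hg, hzg⟩ := Set.mem_iUnion₂.mp hz
  obtain ⟨k, hk⟩ := exists_mem_smul_triangle z
  rcases hp.cases_of_apply_mem hk hzg with rfl | ⟨rfl, h⟩ | ⟨rfl | rfl, -⟩
  · exact Set.mem_iUnion₂.mpr ⟨_, hg, hk⟩
  · have hk' := Set.mem_smul_set_iff_inv_smul_mem.mp hk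
    refine Set.mem_iUnion₂.mpr ⟨_, hg, ?_⟩
    rw [hp.eq_I_iff _ hk'] at h
    rw [Set.mem_smul_set_iff_inv_smul_mem, mul_inv_rev, mul_smul, gen₀_inv, mem_triangle_iff,
      gen₀_smul_re, h]
    norm_num
    positivity
  · refine Set.mem_iUnion₂.mpr ⟨k, ?_, hk⟩
    have h2 := hA _ (hA _ hg)
    rwa [mul_assoc, mul_assoc, gen₁_mul_gen₁, mul_inv_cancel, mul_one] at h2
  · refine Set.mem_iUnion₂.mpr ⟨k, ?_, hk⟩
    have h2 := hA _ hg
    rwa [mul_assoc, inv_mul_cancel, mul_one] at h2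

end

/-! ### The cyclic orientation -/

open Real in
lemma sbtw_add_third (α : Real.Angle) :
    sbtw α (α + ((2 * π / 3 : ℝ) : Real.Angle))
      (α + ((2 * π / 3 : ℝ) : Real.Angle) + ((2 * π / 3 : ℝ) : Real.Angle)) := by
  have hπ := Real.pi_pos
  have key : ∀ (a b c : Real.Angle) (s t : ℝ), b - a = s → c - a = t → 0 ≤ s → s < 2 * π →
      0 < t → t ≤ 2 * π → (btw a b c ↔ s ≤ t) := by
    intro a b c s t hs ht hs0 hs1 ht0 ht1
    change (fun x : Real.Angle => (QuotientAddGroup.equivIcoMod Real.two_pi_pos 0 x : ℝ)) (b - a) ≤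
      (fun x : Real.Angle => (QuotientAddGroup.equivIocMod Real.two_pi_pos 0 x : ℝ)) (c - a) ↔ _
    rw [hs, ht]
    change toIcoMod Real.two_pi_pos 0 s ≤ toIocMod Real.two_pi_pos 0 t ↔ _
    rw [(toIcoMod_eq_self Real.two_pi_pos).mpr ⟨hs0, by linarith⟩,
      (toIocMod_eq_self Real.two_pi_pos).mpr ⟨ht0, by linarith⟩]
  -- Strict betweenness is the negation of `btw` with the outer points exchanged; measured from the
  -- third point, the second lies at `4π/3` and the first at `2π/3`.
  rw [sbtw_iff_not_btw, key _ _ _ (4 * π / 3) (2 * π / 3)]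
  · linarith
  · rw [sub_add_cancel_left, ← Real.Angle.coe_neg, Real.Angle.angle_eq_iff_two_pi_dvd_sub]
    exact ⟨-1, by push_cast; ring⟩
  · rw [add_assoc, sub_add_cancel_left, ← Real.Angle.coe_add, ← Real.Angle.coe_neg,
      Real.Angle.angle_eq_iff_two_pi_dvd_sub]
    exact ⟨-1, by push_cast; ring⟩
  all_goals first | positivity | linarith

lemma sub_conj_ne_zero (z w : ℍ) : (w : ℂ) - (starRingEnd ℂ) (z : ℂ) ≠ 0 := by
  intro h
  have := congrArg Complex.im h
  simp at this
  linarith [z.im_pos, w.im_pos]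

lemma sub_ne_zero_of_ne {z w : ℍ} (h : w ≠ z) : (w : ℂ) - z ≠ 0 :=
  sub_ne_zero.mpr fun h' => h (UpperHalfPlane.ext h')

/-- The factor by which an isometry rotates the directions at a point. -/
lemma exists_direction_smul (g : PSL(2, ℤ)) (v : ℍ) :
    ∃ θ : Real.Angle, ∀ w, w ≠ v → direction (g • v) (g • w) = direction v w + θ := by
  induction g using QuotientGroup.induction_on with | H A =>
  have hdet : (A 0 0 : ℂ) * A 1 1 - A 0 1 * A 1 0 = 1 := by
    have := A.det_coe
    rw [Matrix.det_fin_two] at this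
    exact_mod_cast this
  have hne : ∀ z : ℂ, z.im ≠ 0 → (A 1 0 : ℂ) * z + A 1 1 ≠ 0 := by
    intro z hz h
    have h1 := congrArg Complex.im h
    simp [hz] at h1
    rw [h1] at h hdet
    simp at h
    rw [h] at hdet
    simp at hdet
  have hv := hne v v.im_ne_zero
  have hv' := hne ((starRingEnd ℂ) (v : ℂ)) (by simpa using v.im_ne_zero)
  -- With `c`, `d` the lower row of `A`, a difference `Az - Az'` equals `(z - z') / ((cz + d)(cz' +
  -- d))`. In the quotient that defines the direction the factor `cw + d` cancels, which leaves `(c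
  -- * conj v + d) / (c * v + d)`, independent of `w`.
  refine ⟨(Complex.arg (((A 1 0 : ℂ) * (starRingEnd ℂ) (v : ℂ) + A 1 1) /
    ((A 1 0 : ℂ) * v + A 1 1)) : ℝ), fun w hw => ?_⟩
  have hw' := hne w w.im_ne_zero
  have hsc := sub_conj_ne_zero v w
  rw [direction, direction, ← Complex.arg_mul_coe_angle (div_ne_zero (sub_ne_zero_of_ne hw) hsc)
    (div_ne_zero hv' hv)]
  congr 2
  have e1 : (((QuotientGroup.mk A : PSL(2, ℤ)) • w : ℍ) : ℂ) =
      (A 0 0 * w + A 0 1) / (A 1 0 * w + A 1 1) := by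
    rw [mk_smul, coe_specialLinearGroup_apply]; simp
  have e2 : (((QuotientGroup.mk A : PSL(2, ℤ)) • v : ℍ) : ℂ) =
      (A 0 0 * v + A 0 1) / (A 1 0 * v + A 1 1) := by
    rw [mk_smul, coe_specialLinearGroup_apply]; simp
  rw [e1, e2, map_div₀, map_add, map_add, map_mul, map_mul]
  simp only [map_intCast]
  set u := (starRingEnd ℂ) (v : ℂ)
  have n1 : (A 0 0 * w + A 0 1 : ℂ) / (A 1 0 * w + A 1 1) -
      (A 0 0 * v + A 0 1) / (A 1 0 * v + A 1 1) =
      (w - v) / ((A 1 0 * w + A 1 1) * (A 1 0 * v + A 1 1)) := by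
    rw [div_sub_div _ _ hw' hv]
    congr 1
    linear_combination ((w : ℂ) - v) * hdet
  have n2 : (A 0 0 * w + A 0 1 : ℂ) / (A 1 0 * w + A 1 1) -
      (A 0 0 * u + A 0 1) / (A 1 0 * u + A 1 1) =
      (w - u) / ((A 1 0 * w + A 1 1) * (A 1 0 * u + A 1 1)) := by
    rw [div_sub_div _ _ hw' hv']
    congr 1
    linear_combination ((w : ℂ) - u) * hdet
  rw [n1, n2]
  generalize (A 1 0 : ℂ) * w + A 1 1 = a at *
  generalize (A 1 0 : ℂ) * v + A 1 1 = b at *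
  generalize (A 1 0 : ℂ) * u + A 1 1 = c at *
  field_simp

/-- `gen₁` rotates by `2π/3` around its fixed point. -/
lemma direction_gen₁_smul {w : ℍ} (hw : w ≠ rho) :
    direction rho (gen₁ • w) = direction rho w + ((2 * Real.pi / 3 : ℝ) : Real.Angle) := by
  have hπ := Real.pi_pos
  set r : ℂ := (rho : ℂ) with hr
  set u : ℂ := (starRingEnd ℂ) r with hu
  have h3 : √3 ^ 2 = 3 := Real.sq_sqrt (by norm_num)
  have hru : r * u = 1 := by
    rw [hu, Complex.mul_conj, Complex.normSq_eq_norm_sq, hr, rho_mem_seg.1]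
    norm_num
  have hsum : r + u = 1 := by
    rw [hu, Complex.add_conj]
    change ((2 * (1 / 2) : ℝ) : ℂ) = 1
    norm_num
  have hr2 : r ^ 2 = Complex.exp ((2 * Real.pi / 3 : ℝ) * Complex.I) := by
    have h5 : 2 * Real.pi / 3 = Real.pi - Real.pi / 3 := by ring
    apply Complex.ext
    · rw [Complex.exp_ofReal_mul_I_re, h5, Real.cos_pi_sub, Real.cos_pi_div_three, pow_two,
        Complex.mul_re]
      change (1 / 2 : ℝ) * (1 / 2) - √3 / 2 * (√3 / 2) = _
      nlinarith
    · rw [Complex.exp_ofReal_mul_I_im, h5, Real.sin_pi_sub, Real.sin_pi_div_three, pow_two,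
        Complex.mul_im]
      change (1 / 2 : ℝ) * (√3 / 2) + √3 / 2 * (1 / 2) = _
      ring
  have hr0 : r ≠ 0 := rho.ne_zero
  have harg : Complex.arg (r ^ 2) = 2 * Real.pi / 3 := by
    rw [hr2, Complex.arg_exp_mul_I, toIocMod_eq_self]
    constructor <;> linarith
  have hsc : (w : ℂ) - u ≠ 0 := sub_conj_ne_zero rho w
  have hw1 : (1 : ℂ) - w ≠ 0 := by
    intro h
    have := congrArg Complex.im h
    simp at this
    exact w.im_ne_zero this
  rw [direction, direction, ← harg, ← Complex.arg_mul_coe_angle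
    (div_ne_zero (sub_ne_zero_of_ne hw) hsc) (pow_ne_zero 2 hr0), gen₁_smul_coe, ← hr, ← hu]
  congr 2
  -- In the disc coordinate centred at `rho`, `gen₁` is multiplication by `r / u`, which is `r ^ 2`
  -- because `r * u = 1`.
  have n1 : 1 / (1 - (w : ℂ)) - r = r * (w - r) / (1 - w) := by
    rw [div_sub' hw1]
    congr 1
    linear_combination -hru + r * hsum
  have n2 : 1 / (1 - (w : ℂ)) - u = u * (w - u) / (1 - w) := by
    rw [div_sub' hw1]
    congr 1
    linear_combination -hru + u * hsum
  have hu0 : u ≠ 0 := right_ne_zero_of_mul_eq_one hru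
  rw [n1, n2]
  field_simp
  linear_combination -((w : ℂ) - r) * hru

/-- At `rho` the three directions differ by successive rotations through `2π/3`, as `gen₁⁻¹` is the
square of `gen₁`; the isometry `g` adds the same angle to all of them. -/
lemma sbtw_direction (g : PSL(2, ℤ)) :
    sbtw (direction (g • rho) (g • I)) (direction (g • rho) ((g * gen₁) • I))
      (direction (g • rho) ((g * gen₁⁻¹) • I)) := by
  obtain ⟨θ, hθ⟩ := exists_direction_smul g rho
  have hne : ∀ k : PSL(2, ℤ), k • rho = rho → k • (I : ℍ) ≠ rho := by
    intro k hk h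
    rw [← hk, smul_left_cancel_iff] at h
    exact rho_ne_I h.symm
  have h0 := hθ I rho_ne_I.symm
  have h1 := hθ (gen₁ • I) (hne _ gen₁_smul_rho)
  have h2 := hθ (gen₁⁻¹ • I) (hne _ gen₁_inv_smul_rho)
  rw [direction_gen₁_smul rho_ne_I.symm, add_right_comm, ← h0] at h1
  rw [← gen₁_mul_gen₁, mul_smul, direction_gen₁_smul (hne _ gen₁_smul_rho),
    direction_gen₁_smul rho_ne_I.symm, add_right_comm _ _ θ, add_right_comm _ _ θ, ← h0] at h2
  rw [mul_smul, mul_smul, h1, ← gen₁_mul_gen₁, mul_smul gen₁ gen₁, h2]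
  exact sbtw_add_third _

lemma cyclicallyOrdered_edgeOf (g : PSL(2, ℤ)) :
    CyclicallyOrdered (treeH.end₁ (edgeOf g)) (edgeOf g) (edgeOf (g * gen₁))
      (edgeOf (g * gen₁⁻¹)) := by
  rw [CyclicallyOrdered, pt₁_end₁_edgeOf, pt₀_end₀_edgeOf, pt₀_end₀_edgeOf, pt₀_end₀_edgeOf]
  exact sbtw_direction g

lemma not_cyclicallyOrdered_edgeOf (g : PSL(2, ℤ)) :
    ¬ CyclicallyOrdered (treeH.end₁ (edgeOf g)) (edgeOf g) (edgeOf (g * gen₁⁻¹))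
      (edgeOf (g * gen₁)) := by
  rw [CyclicallyOrdered, pt₁_end₁_edgeOf, pt₀_end₀_edgeOf, pt₀_end₀_edgeOf, pt₀_end₀_edgeOf]
  exact fun h => (sbtw_direction g).not_sbtw (sbtw_cyclic.mp (sbtw_cyclic.mp h))

end ModularTree

/-! ### Potentials on trees and connectivity of bipartite graphs -/

/-- On a tree every group-valued cocycle on the oriented edges has a potential. -/
lemma SimpleGraph.IsTree.exists_potential {V Γ : Type*} [Group Γ] {S : SimpleGraph V}
    (hS : S.IsTree) (c : V → V → Γ) (hc : ∀ v w, S.Adj v w → c v w * c w v = 1) :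
    ∃ φ : V → Γ, ∀ v w, S.Adj v w → φ w = φ v * c v w := by
  obtain ⟨r⟩ := hS.1.nonempty
  choose p hp _ using hS.existsUnique_path r
  have hconcat : ∀ v w (q : S.Walk r v) (h : S.Adj v w),
      ((q.concat h).darts.map fun d => c d.fst d.snd).prod =
        (q.darts.map fun d => c d.fst d.snd).prod * c v w := by
    intro v w q h
    simp [SimpleGraph.Walk.darts_concat]
  refine ⟨fun v => ((p v).darts.map fun d => c d.fst d.snd).prod, fun v w h => ?_⟩
  beta_reduce
  -- In a tree, of the paths from the root to two adjacent vertices, one prolongs the other by their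
  -- edge.
  by_cases hv : v ∈ (p w).support
  · rw [hS.2.path_concat (hp v) (hp w) h hv, hconcat]
  · have hw := hS.2.mem_support_of_ne_mem_support_of_adj_of_isPath (hp v) (hp w) h hv
    rw [hS.2.path_concat (hp w) (hp v) h.symm hw, hconcat, mul_assoc, hc _ _ h.symm, mul_one]

namespace ModularTree

namespace BiGraph

variable {X : BiGraph}

lemma toSimpleGraph_adj (x : X.E) :
    X.toSimpleGraph.Adj (Sum.inl (X.end₀ x)) (Sum.inr (X.end₁ x)) := by
  rw [toSimpleGraph, SimpleGraph.fromRel_adj]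
  exact ⟨Sum.inl_ne_inr, Or.inl ⟨x, rfl, rfl⟩⟩

lemma exists_of_adj {a b : X.V₀ ⊕ X.V₁} (h : X.toSimpleGraph.Adj a b) :
    ∃ x, (a = Sum.inl (X.end₀ x) ∧ b = Sum.inr (X.end₁ x)) ∨
      (b = Sum.inl (X.end₀ x) ∧ a = Sum.inr (X.end₁ x)) := by
  rw [toSimpleGraph, SimpleGraph.fromRel_adj] at h
  rcases h with ⟨-, ⟨x, hx⟩ | ⟨x, hx⟩⟩
  · exact ⟨x, Or.inl hx⟩
  · exact ⟨x, Or.inr hx⟩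

/-- A property of the edges of a connected graph that is inherited by adjacent edges holds for all
edges if it holds for one. -/
lemma edge_induction (hX : X.toSimpleGraph.Connected) {P : X.E → Prop}
    (h0 : ∀ x y, X.end₀ x = X.end₀ y → P x → P y) (h1 : ∀ x y, X.end₁ x = X.end₁ y → P x → P y)
    {x₀ : X.E} (hx₀ : P x₀) (y : X.E) : P y := by
  -- The property is carried from vertex to vertex along a walk in the form "all edges at this
  -- vertex satisfy `P`".
  let Q : X.V₀ ⊕ X.V₁ → Prop :=
    Sum.elim (fun v => ∀ x, X.end₀ x = v → P x) (fun v => ∀ x, X.end₁ x = v → P x)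
  have hstep : ∀ a b, X.toSimpleGraph.Adj a b → Q a → Q b := by
    intro a b hab ha
    obtain ⟨x, ⟨rfl, rfl⟩ | ⟨rfl, rfl⟩⟩ := exists_of_adj hab
    · exact fun z hz => h1 x z hz.symm (ha x rfl)
    · exact fun z hz => h0 x z hz.symm (ha x rfl)
  have hwalk : ∀ a b, X.toSimpleGraph.Walk a b → Q a → Q b := by
    intro a b q
    induction q with
    | nil => exact id
    | cons hab _ ih => exact fun ha => ih (hstep _ _ hab ha)
  obtain ⟨q⟩ := hX.preconnected (Sum.inl (X.end₀ x₀)) (Sum.inl (X.end₀ y))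
  exact hwalk _ _ q (fun z hz => h0 x₀ z hz.symm hx₀) y rfl

lemma cut_end₀_eq_iff {C : Set X.V₀} {x y : X.E} :
    (X.cut C).end₀ x = (X.cut C).end₀ y ↔ x = y ∨ (X.end₀ x ∉ C ∧ X.end₀ x = X.end₀ y) := by
  classical
  simp only [cut]
  split_ifs with hx hy hy
  · simp [hx]
  · simp only [hx, not_true, false_and, or_false, false_iff]
    rintro rfl
    exact hy hx
  · simp only [false_iff, not_or, not_and]
    exact ⟨fun h => hx (h ▸ hy), fun _ h => hx (h ▸ hy)⟩
  · simp only [Sum.inl.injEq, Subtype.mk.injEq, hx, not_false_eq_true, true_and]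
    exact ⟨Or.inr, fun h => h.elim (congrArg _) id⟩

end BiGraph

open BiGraph

/-! ### The edges of `X_comb(G)` -/

section

variable (G : Subgroup PSL(2, ℤ))

/-- The coset `G g`, as an edge of `X_comb(G)`. -/
def coset (g : PSL(2, ℤ)) : RightCosets G := Quotient.mk (QuotientGroup.rightRel G) g

/-- The map `x ↦ x h` on `G \ Γ`. -/
def rightMul (h : PSL(2, ℤ)) : RightCosets G → RightCosets G :=
  Quotient.map (fun g => g * h) (by
    intro a b hab
    have h : b * a⁻¹ ∈ G := QuotientGroup.rightRel_apply.mp hab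
    refine QuotientGroup.rightRel_apply.mpr ?_
    simpa [mul_assoc] using h)

variable {G}

lemma exists_eq_coset (x : RightCosets G) : ∃ g, x = coset G g := by
  induction x using Quotient.inductionOn with | h g => exact ⟨g, rfl⟩

lemma coset_mul (g h : PSL(2, ℤ)) : coset G (g * h) = rightMul G h (coset G g) := rfl

lemma coset_mul_left {g : PSL(2, ℤ)} (hg : g ∈ G) (h : PSL(2, ℤ)) :
    coset G (g * h) = coset G h :=
  Quotient.sound (QuotientGroup.rightRel_apply.mpr (by simpa using hg))

lemma coset_eq_iff {g h : PSL(2, ℤ)} : coset G g = coset G h ↔ h * g⁻¹ ∈ G :=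
  Quotient.eq.trans QuotientGroup.rightRel_apply

lemma rightMul_one (x : RightCosets G) : rightMul G 1 x = x := by
  obtain ⟨g, rfl⟩ := exists_eq_coset x
  rw [← coset_mul, mul_one]

lemma rightMul_rightMul (h h' : PSL(2, ℤ)) (x : RightCosets G) :
    rightMul G h' (rightMul G h x) = rightMul G (h * h') x := by
  obtain ⟨g, rfl⟩ := exists_eq_coset x
  rw [← coset_mul, ← coset_mul, ← coset_mul, mul_assoc]

lemma rightMul_eq_iff {h : PSL(2, ℤ)} {x y : RightCosets G} :
    rightMul G h x = y ↔ x = rightMul G h⁻¹ y := by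
  constructor
  · rintro rfl
    rw [rightMul_rightMul, mul_inv_cancel, rightMul_one]
  · rintro rfl
    rw [rightMul_rightMul, inv_mul_cancel, rightMul_one]

lemma nextEdge_eq (x : RightCosets G) : nextEdge G x = rightMul G gen₁ x := rfl

lemma nextEdge_nextEdge (x : RightCosets G) :
    nextEdge G (nextEdge G x) = rightMul G gen₁⁻¹ x := by
  rw [nextEdge_eq, nextEdge_eq, rightMul_rightMul, gen₁_mul_gen₁]

lemma toDoubleCoset_eq_iff {H : Subgroup PSL(2, ℤ)} {x y : RightCosets G} :
    toDoubleCoset G H x = toDoubleCoset G H y ↔ ∃ h ∈ H, y = rightMul G h x := by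
  obtain ⟨a, rfl⟩ := exists_eq_coset x
  obtain ⟨b, rfl⟩ := exists_eq_coset y
  have h : toDoubleCoset G H (coset G a) = toDoubleCoset G H (coset G b) ↔
      ∃ g ∈ G, ∃ h ∈ H, b = g * a * h :=
    (Quotient.eq (r := DoubleCoset.setoid (G : Set PSL(2, ℤ)) H)).trans DoubleCoset.rel_iff
  rw [h]
  constructor
  · rintro ⟨g, hg, k, hk, rfl⟩
    exact ⟨k, hk, by rw [mul_assoc, coset_mul_left hg, coset_mul]⟩
  · rintro ⟨h, hh, hb⟩
    rw [← coset_mul, coset_eq_iff] at hb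
    exact ⟨_, inv_mem hb, h, hh, by group⟩

lemma rightMul_gen₀_eq_self {h : PSL(2, ℤ)} (hh : h ∈ G₀) (h1 : h ≠ 1) {x : RightCosets G}
    (hx : rightMul G h x = x) : rightMul G gen₀ x = x := by
  rcases mem_G₀_iff.mp hh with rfl | rfl
  · exact absurd rfl h1
  · exact hx

lemma rightMul_gen₁_inv_eq_self_iff {x : RightCosets G} :
    rightMul G gen₁⁻¹ x = x ↔ rightMul G gen₁ x = x := by
  rw [rightMul_eq_iff, inv_inv, eq_comm]

/-- In a group of order 3 a stabilizer is trivial or everything. This is what makes every vertex of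
type (1) univalent or trivalent. -/
lemma rightMul_gen₁_eq_self {h : PSL(2, ℤ)} (hh : h ∈ G₁) (h1 : h ≠ 1) {x : RightCosets G}
    (hx : rightMul G h x = x) : rightMul G gen₁ x = x := by
  rcases mem_G₁_iff.mp hh with rfl | rfl | rfl
  · exact absurd rfl h1
  · exact hx
  · exact rightMul_gen₁_inv_eq_self_iff.mp hx

variable {C : Set (Xcomb G).V₀}

variable (C) in
/-- The extremity of type (0) of an edge of `X'`. -/
noncomputable def cutEnd₀ (x : RightCosets G) : (cutGraph G C).V₀ := (cutGraph G C).end₀ x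

variable (C) in
/-- The extremity of type (1) of an edge of `X'`. -/
noncomputable def cutEnd₁ (x : RightCosets G) : (cutGraph G C).V₁ := (cutGraph G C).end₁ x

lemma cutEnd₀_eq_iff {x y : RightCosets G} :
    cutEnd₀ C x = cutEnd₀ C y ↔ y = x ∨ (toDoubleCoset G G₀ x ∉ C ∧ y = rightMul G gen₀ x) := by
  have h : cutEnd₀ C x = cutEnd₀ C y ↔
      x = y ∨ (toDoubleCoset G G₀ x ∉ C ∧ toDoubleCoset G G₀ x = toDoubleCoset G G₀ y) :=
    cut_end₀_eq_iff
  rw [h, toDoubleCoset_eq_iff, eq_comm]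
  simp only [mem_G₀_iff, exists_eq_or_imp, exists_eq_left, rightMul_one]
  tauto

lemma cutEnd₁_eq_iff {x y : RightCosets G} :
    cutEnd₁ C x = cutEnd₁ C y ↔ y = x ∨ y = rightMul G gen₁ x ∨ y = rightMul G gen₁⁻¹ x := by
  have h : cutEnd₁ C x = cutEnd₁ C y ↔ ∃ h ∈ G₁, y = rightMul G h x := toDoubleCoset_eq_iff
  rw [h]
  simp only [mem_G₁_iff, exists_eq_or_imp, exists_eq_left, rightMul_one]

lemma valency₁_cutEnd₁ (x : RightCosets G) : (cutGraph G C).valency₁ (cutEnd₁ C x) =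
    ({x, rightMul G gen₁ x, rightMul G gen₁⁻¹ x} : Set (RightCosets G)).encard := by
  have h : {y : RightCosets G | cutEnd₁ C y = cutEnd₁ C x} =
      {x, rightMul G gen₁ x, rightMul G gen₁⁻¹ x} := by
    ext y
    rw [Set.mem_ofPred_eq, eq_comm, cutEnd₁_eq_iff]
    rfl
  exact congrArg Set.encard h

lemma valency₁_eq_one {x : RightCosets G} (hx : rightMul G gen₁ x = x) :
    (cutGraph G C).valency₁ (cutEnd₁ C x) = 1 := by
  rw [valency₁_cutEnd₁, rightMul_gen₁_inv_eq_self_iff.mpr hx, hx, Set.pair_eq_singleton,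
    Set.pair_eq_singleton, Set.encard_singleton]

lemma valency₁_eq_three {x : RightCosets G} (hx : rightMul G gen₁ x ≠ x) :
    (cutGraph G C).valency₁ (cutEnd₁ C x) = 3 := by
  rw [valency₁_cutEnd₁]
  refine Set.encard_eq_three.mpr ⟨x, _, _, hx.symm, fun h => ?_, fun h => ?_, rfl⟩
  · exact hx (rightMul_gen₁_inv_eq_self_iff.mp h.symm)
  · rw [rightMul_eq_iff, rightMul_rightMul, ← mul_inv_rev, gen₁_mul_gen₁, inv_inv] at h
    exact hx h.symm

lemma cutEnd₀_surjective : Function.Surjective (cutEnd₀ C) := by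
  rintro (⟨v, hv⟩ | ⟨x, hx⟩)
  · obtain ⟨g, rfl⟩ := Quotient.exists_rep v
    exact ⟨coset G g, dif_neg hv⟩
  · exact ⟨x, dif_pos hx⟩

lemma cutEnd₁_surjective : Function.Surjective (cutEnd₁ C) := by
  intro v
  obtain ⟨g, rfl⟩ := Quotient.exists_rep v
  exact ⟨coset G g, rfl⟩

lemma cutGraph_edge_induction (hX : (cutGraph G C).toSimpleGraph.Connected)
    {P : RightCosets G → Prop} (h0 : ∀ x y, cutEnd₀ C x = cutEnd₀ C y → P x → P y)
    (h1 : ∀ x y, cutEnd₁ C x = cutEnd₁ C y → P x → P y)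
    {x₀ : RightCosets G} (hx₀ : P x₀) (y : RightCosets G) : P y :=
  edge_induction hX h0 h1 hx₀ y

end

/-! ### Developments of the cut graph -/

/-- A map from the edges of `X'` to `Γ` that commutes with the right multiplications by the
generators, at the vertices of `X'` with several edges. -/
structure IsDevelopment {G : Subgroup PSL(2, ℤ)} (C : Set (Xcomb G).V₀)
    (d : RightCosets G → PSL(2, ℤ)) : Prop where
  map_gen₀ : ∀ x, toDoubleCoset G G₀ x ∉ C → rightMul G gen₀ x ≠ x →
    d (rightMul G gen₀ x) = d x * gen₀
  map_gen₁ : ∀ x, rightMul G gen₁ x ≠ x → d (rightMul G gen₁ x) = d x * gen₁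

section

variable {G : Subgroup PSL(2, ℤ)} {C : Set (Xcomb G).V₀} {d d' : RightCosets G → PSL(2, ℤ)}

lemma IsDevelopment.map_gen₁_inv (hd : IsDevelopment C d) {x : RightCosets G}
    (hx : rightMul G gen₁ x ≠ x) : d (rightMul G gen₁⁻¹ x) = d x * gen₁⁻¹ := by
  have h : rightMul G gen₁ (rightMul G gen₁⁻¹ x) = x := by
    rw [rightMul_rightMul, inv_mul_cancel, rightMul_one]
  have h1 := hd.map_gen₁ (rightMul G gen₁⁻¹ x) (by
    rw [h]
    exact fun h' => hx (rightMul_gen₁_inv_eq_self_iff.mp h'.symm))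
  rw [h] at h1
  rw [h1, mul_inv_cancel_right]

lemma IsDevelopment.cases_of_end₀_eq (hd : IsDevelopment C d) {x y : RightCosets G}
    (h : cutEnd₀ C x = cutEnd₀ C y) :
    y = x ∨ (toDoubleCoset G G₀ x ∉ C ∧ y = rightMul G gen₀ x ∧ d y = d x * gen₀) := by
  rw [cutEnd₀_eq_iff] at h
  by_cases hyx : y = x
  · exact Or.inl hyx
  · obtain ⟨hC, rfl⟩ := h.resolve_left hyx
    exact Or.inr ⟨hC, rfl, hd.map_gen₀ x hC hyx⟩

lemma IsDevelopment.cases_of_end₁_eq (hd : IsDevelopment C d) {x y : RightCosets G}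
    (h : cutEnd₁ C x = cutEnd₁ C y) :
    y = x ∨ (rightMul G gen₁ x ≠ x ∧ ((y = rightMul G gen₁ x ∧ d y = d x * gen₁) ∨
      (y = rightMul G gen₁⁻¹ x ∧ d y = d x * gen₁⁻¹))) := by
  rw [cutEnd₁_eq_iff] at h
  by_cases hx : rightMul G gen₁ x = x
  · rw [rightMul_gen₁_inv_eq_self_iff.mpr hx, hx] at h
    tauto
  · rcases h with h | rfl | rfl
    · exact Or.inl h
    · exact Or.inr ⟨hx, Or.inl ⟨rfl, hd.map_gen₁ x hx⟩⟩
    · exact Or.inr ⟨hx, Or.inr ⟨rfl, hd.map_gen₁_inv hx⟩⟩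

/-- Two developments differ by a left multiplication. -/
lemma IsDevelopment.eq_mul (hX : (cutGraph G C).toSimpleGraph.Connected) (hd : IsDevelopment C d)
    (hd' : IsDevelopment C d') {x₀ : RightCosets G} (hx₀ : d x₀ = 1) (x : RightCosets G) :
    d' x = d' x₀ * d x := by
  refine cutGraph_edge_induction hX (P := fun x : RightCosets G => d' x = d' x₀ * d x) ?_ ?_
    (x₀ := x₀) ?_ x
  · intro x y h hx
    rcases hd.cases_of_end₀_eq h with h1 | ⟨-, h0, h1⟩
    · rwa [h1]
    rcases hd'.cases_of_end₀_eq h with h2 | ⟨-, -, h2⟩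
    · rwa [h2]
    rw [h1, h2, hx, mul_assoc]
  · intro x y h hx
    rcases hd.cases_of_end₁_eq h with rfl | ⟨hne, ⟨rfl, h1⟩ | ⟨rfl, h1⟩⟩
    · exact hx
    · rw [h1, hd'.map_gen₁ x hne, hx, mul_assoc]
    · rw [h1, hd'.map_gen₁_inv hne, hx, mul_assoc]
  · rw [hx₀, mul_one]

/-- The projection to `G \ Γ` commutes with right multiplications, so being a section of it passes
from edge to edge. In particular such a development is injective. -/
lemma IsDevelopment.coset_apply (hX : (cutGraph G C).toSimpleGraph.Connected)
    (hd : IsDevelopment C d) {x₀ : RightCosets G} (hx₀ : coset G (d x₀) = x₀)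
    (x : RightCosets G) : coset G (d x) = x := by
  refine cutGraph_edge_induction hX (P := fun x : RightCosets G => coset G (d x) = x) ?_ ?_ hx₀ x
  · intro x y h hx
    rcases hd.cases_of_end₀_eq h with rfl | ⟨-, rfl, h1⟩
    · exact hx
    · rw [h1, coset_mul, hx]
  · intro x y h hx
    rcases hd.cases_of_end₁_eq h with rfl | ⟨-, ⟨rfl, h1⟩ | ⟨rfl, h1⟩⟩
    · exact hx
    · rw [h1, coset_mul, hx]
    · rw [h1, coset_mul, hx]

/-- Choose a base edge at every vertex and write it as `x * α x`, respectively `x * β x`, for each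
edge `x` at this vertex. A development should make `d x * α x` and `d x * β x` depend only on the
vertices; these values then form a potential `φ` of the cocycle `(α x)⁻¹ * β x`, which exists since
`X'` is a tree. -/
lemma exists_isDevelopment (hX' : (cutGraph G C).IsTree) :
    ∃ d : RightCosets G → PSL(2, ℤ), IsDevelopment C d ∧ d (distEdge G) = 1 := by
  classical
  obtain ⟨b₀, hb₀⟩ := (cutEnd₀_surjective (C := C)).hasRightInverse
  obtain ⟨b₁, hb₁⟩ := (cutEnd₁_surjective (C := C)).hasRightInverse
  have hα : ∀ x : RightCosets G, ∃ h ∈ G₀, b₀ (cutEnd₀ C x) = rightMul G h x := by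
    intro x
    rcases cutEnd₀_eq_iff.mp (hb₀ (cutEnd₀ C x)).symm with h | ⟨-, h⟩
    · exact ⟨1, one_mem _, by rw [h, rightMul_one]⟩
    · exact ⟨gen₀, mem_G₀_iff.mpr (Or.inr rfl), h⟩
  have hβ : ∀ x : RightCosets G, ∃ h ∈ G₁, b₁ (cutEnd₁ C x) = rightMul G h x :=
    fun x => (toDoubleCoset_eq_iff (y := b₁ (cutEnd₁ C x))).mp (hb₁ (cutEnd₁ C x)).symm
  choose α hαG hα using hα
  choose β hβG hβ using hβ
  let m : (cutGraph G C).V₀ → (cutGraph G C).V₁ → PSL(2, ℤ) := fun v w =>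
    if h : ∃ x : RightCosets G, cutEnd₀ C x = v ∧ cutEnd₁ C x = w then
      (α h.choose)⁻¹ * β h.choose else 1
  have hm : ∀ x : RightCosets G,
      m (cutEnd₀ C x) (cutEnd₁ C x) = (α x)⁻¹ * β x := by
    intro x
    have h : ∃ y : RightCosets G, cutEnd₀ C y = cutEnd₀ C x ∧
      cutEnd₁ C y = cutEnd₁ C x := ⟨x, rfl, rfl⟩
    have hx : h.choose = x := hX'.1 _ _ h.choose_spec.1 h.choose_spec.2
    simp only [m]
    rw [dif_pos h, hx]
  let c : (cutGraph G C).V₀ ⊕ (cutGraph G C).V₁ → (cutGraph G C).V₀ ⊕ (cutGraph G C).V₁ →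
      PSL(2, ℤ)
    | Sum.inl v, Sum.inr w => m v w
    | Sum.inr w, Sum.inl v => (m v w)⁻¹
    | _, _ => 1
  obtain ⟨φ, hφ⟩ := hX'.2.exists_potential c (by
    intro a b hab
    obtain ⟨x, ⟨rfl, rfl⟩ | ⟨rfl, rfl⟩⟩ := exists_of_adj hab <;> simp [c])
  let d : RightCosets G → PSL(2, ℤ) := fun x => φ (Sum.inl (cutEnd₀ C x)) * (α x)⁻¹
  have hd1 : ∀ x, d x = φ (Sum.inr (cutEnd₁ C x)) * (β x)⁻¹ := by
    intro x
    have hadj : (cutGraph G C).toSimpleGraph.Adj (Sum.inl (cutEnd₀ C x)) (Sum.inr (cutEnd₁ C x)) :=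
      toSimpleGraph_adj (X := cutGraph G C) x
    rw [hφ _ _ hadj]
    simp only [c, d]
    rw [hm]
    group
  have hd : IsDevelopment C d := by
    refine ⟨fun x hC hx => ?_, fun x hx => ?_⟩
    · have he : cutEnd₀ C x = cutEnd₀ C (rightMul G gen₀ x) :=
        cutEnd₀_eq_iff.mpr (Or.inr ⟨hC, rfl⟩)
      -- Both edges lead to the same base edge, so this element of `G₀` fixes `x`; were it
      -- nontrivial, `gen₀` would fix `x` as well.
      have h1 : gen₀ * α (rightMul G gen₀ x) * (α x)⁻¹ = 1 := by
        by_contra hne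
        refine hx (rightMul_gen₀_eq_self (mul_mem (mul_mem (mem_G₀_iff.mpr (Or.inr rfl))
          (hαG _)) (inv_mem (hαG _))) hne ?_)
        rw [← rightMul_rightMul, ← rightMul_rightMul, ← hα, ← he, hα, rightMul_rightMul,
          mul_inv_cancel, rightMul_one]
      have h2 : α x = gen₀ * α (rightMul G gen₀ x) := (mul_inv_eq_one.mp h1).symm
      simp only [d]
      rw [← he, h2]
      group
    · have he : cutEnd₁ C x = cutEnd₁ C (rightMul G gen₁ x) :=
        cutEnd₁_eq_iff.mpr (Or.inr (Or.inl rfl))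
      have h1 : gen₁ * β (rightMul G gen₁ x) * (β x)⁻¹ = 1 := by
        by_contra hne
        refine hx (rightMul_gen₁_eq_self (mul_mem (mul_mem (mem_G₁_iff.mpr (Or.inr (Or.inl rfl)))
          (hβG _)) (inv_mem (hβG _))) hne ?_)
        rw [← rightMul_rightMul, ← rightMul_rightMul, ← hβ, ← he, hβ, rightMul_rightMul,
          mul_inv_cancel, rightMul_one]
      have h2 : β x = gen₁ * β (rightMul G gen₁ x) := (mul_inv_eq_one.mp h1).symm
      rw [hd1, hd1, ← he, h2]
      group
  refine ⟨fun x => (d (distEdge G))⁻¹ * d x, ⟨fun x hC hx => ?_, fun x hx => ?_⟩,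
    inv_mul_cancel _⟩
  · rw [hd.map_gen₀ x hC hx, ← mul_assoc]
  · rw [hd.map_gen₁ x hx, ← mul_assoc]

end

/-! ### The two sides of the imaginary half-axis -/

lemma mat₀_coe : (mat₀ : Matrix (Fin 2) (Fin 2) ℤ) = !![0, -1; 1, 0] := rfl

/-- The sign is that of the real part of `(aρ + b) * conj (cρ + d)`, where `ρ * conj ρ = 1` and `ρ +
conj ρ = 1`. The question about sides thus becomes an inequality between integers. -/
lemma smul_rho_re_pos_iff (A : SL(2, ℤ)) :
    0 < (A • rho).re ↔
      0 < 2 * (A 0 0 * A 1 0 + A 0 1 * A 1 1) + (A 0 0 * A 1 1 + A 0 1 * A 1 0) := by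
  have h3 : √3 ^ 2 = 3 := Real.sq_sqrt (by norm_num)
  have hrr : (rho : ℂ).re = 1 / 2 := rfl
  have hri : (rho : ℂ).im = √3 / 2 := rfl
  have hden : ((A 1 0 : ℂ) * rho + A 1 1) ≠ 0 := by
    have := denom_ne_zero (Matrix.SpecialLinearGroup.mapGL ℝ A) rho
    simpa [denom] using this
  have hpos := Complex.normSq_pos.mpr hden
  have hre : (A • rho).re = ((2 * (A 0 0 * A 1 0 + A 0 1 * A 1 1) +
      (A 0 0 * A 1 1 + A 0 1 * A 1 0) : ℤ) : ℝ) / 2 /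
      Complex.normSq ((A 1 0 : ℂ) * rho + A 1 1) := by
    rw [← coe_re, coe_specialLinearGroup_apply, Complex.div_re]
    simp only [algebraMap_int_eq, eq_intCast, Complex.ofReal_intCast]
    rw [← add_div]
    congr 1
    simp only [Complex.add_re, Complex.add_im, Complex.mul_re, Complex.mul_im,
      Complex.intCast_re, Complex.intCast_im, hrr, hri]
    push_cast
    linear_combination ((A 0 0 : ℝ) * A 1 0 / 4) * h3
  rw [hre, div_pos_iff_of_pos_right hpos, div_pos_iff_of_pos_right two_pos, Int.cast_pos]

/-- An edge of `𝒯` whose extremity of type (0) is not `i` lies on the same side of the imaginary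
half-axis as the other edge with this extremity. -/
lemma smul_rho_re_pos_iff_mul_gen₀ {g : PSL(2, ℤ)} (hg : g ∉ G₀) :
    0 < (g • rho).re ↔ 0 < ((g * gen₀) • rho).re := by
  induction g using QuotientGroup.induction_on with | H A =>
  rw [gen₀, ← QuotientGroup.mk_mul, mk_smul, mk_smul, smul_rho_re_pos_iff, smul_rho_re_pos_iff]
  have hdet : A 0 0 * A 1 1 - A 0 1 * A 1 0 = 1 := by
    have := A.det_coe
    rwa [Matrix.det_fin_two] at this
  have e00 : (A * mat₀) 0 0 = A 0 1 := by
    simp [mat₀_coe, Matrix.mul_apply]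
  have e01 : (A * mat₀) 0 1 = -A 0 0 := by
    simp [mat₀_coe, Matrix.mul_apply]
  have e10 : (A * mat₀) 1 0 = A 1 1 := by
    simp [mat₀_coe, Matrix.mul_apply]
  have e11 : (A * mat₀) 1 1 = -A 1 0 := by
    simp [mat₀_coe, Matrix.mul_apply]
  rw [e00, e01, e10, e11]
  have hI : ¬ (A 0 0 = A 1 1 ∧ A 0 1 = -A 1 0) := by
    rintro ⟨h1, h2⟩
    apply hg
    rw [← smul_I_eq_I_iff, mk_smul]
    ext
    have hne : (A 1 0 : ℂ) * Complex.I + A 1 1 ≠ 0 := by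
      have := denom_ne_zero (Matrix.SpecialLinearGroup.mapGL ℝ A) I
      simpa [denom] using this
    rw [coe_specialLinearGroup_apply]
    simp only [algebraMap_int_eq, eq_intCast, Complex.ofReal_intCast, coe_I]
    rw [div_eq_iff hne, h1, h2]
    push_cast
    linear_combination -(A 1 0 : ℂ) * Complex.I_mul_I
  generalize A 0 0 = a at *
  generalize A 0 1 = b at *
  generalize A 1 0 = c at *
  generalize A 1 1 = e at *
  -- With `s = ac + be` and `m = bc` the two conditions read `0 < 2s + (2m + 1)` and `0 < 2s - (2m +
  -- 1)`; they agree as soon as `2s` dominates in absolute value.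
  have hz : ∀ s m : ℤ, (2 * m + 1) ^ 2 < (2 * s) ^ 2 →
      (0 < 2 * s + (2 * m + 1) ↔ 0 < 2 * s - (2 * m + 1)) := by
    intro s m h
    rw [sq_lt_sq] at h
    rcases abs_cases (2 * m + 1) with h1 | h1 <;> rcases abs_cases (2 * s) with h2 | h2 <;> omega
  have hae : a * e = b * c + 1 := by linarith
  have hPQ : (a * c) * (b * e) = (b * c) * (b * c + 1) := by rw [← hae]; ring
  -- Here `s ^ 2 = (ac - be) ^ 2 + 4m(m + 1)` while `(2m + 1) ^ 2 = 4m(m + 1) + 1`. This suffices if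
  -- `m(m + 1)` is positive; if it vanishes, only `s ≠ 0` is needed, and `s = 0` would make the
  -- matrix fix `I`.
  have hs : (2 * (b * c) + 1) ^ 2 < (2 * (a * c + b * e)) ^ 2 := by
    have hm : 0 ≤ (b * c) * (b * c + 1) := by
      rcases le_or_gt 0 (b * c) with h | h <;> nlinarith
    rcases hm.lt_or_eq with hm | hm
    · nlinarith [sq_nonneg (a * c - b * e)]
    · have hs0 : a * c + b * e ≠ 0 := by
        intro h
        have hb : b * e = -(a * c) := by linarith
        rw [hb, ← hm] at hPQ
        have h1 : a * c = 0 := by nlinarith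
        have h2 : b * e = 0 := by linarith
        rcases mul_eq_zero.mp h1 with rfl | rfl
        · have hbc : b * c = -1 := by linarith
          have hb0 : b ≠ 0 := by rintro rfl; simp at hbc
          refine hI ⟨((mul_eq_zero.mp h2).resolve_left hb0).symm, ?_⟩
          rcases Int.eq_one_or_neg_one_of_mul_eq_neg_one hbc with rfl | rfl <;> linarith
        · have hae1 : a * e = 1 := by linarith
          have he0 : e ≠ 0 := by rintro rfl; simp at hae1
          refine hI ⟨Int.eq_of_mul_eq_one hae1, ?_⟩
          rw [(mul_eq_zero.mp h2).resolve_right he0, neg_zero]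
      have : 1 ≤ (a * c + b * e) ^ 2 := by
        have := sq_pos_of_ne_zero hs0
        omega
      nlinarith
  have := hz _ _ hs
  convert this using 2
  · linear_combination hae
  · linear_combination -hae

open BiGraph

/-! ### Developments, embeddings and lifts -/

section

variable {G : Subgroup PSL(2, ℤ)} {C : Set (Xcomb G).V₀} {d : RightCosets G → PSL(2, ℤ)}

lemma gen₀_smul_rho_re : (gen₀ • rho).re = -1 / 2 := by
  rw [gen₀_smul_re, (mem_seg_iff.mp rho_mem_seg).1, rho_re]
  norm_num

/-- A development does not glue the two edges at a vertex where the graph has been cut. -/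
lemma IsDevelopment.apply_ne (hX : (cutGraph G C).toSimpleGraph.Connected)
    (hd : IsDevelopment C d) (hcos : ∀ x, coset G (d x) = x) {x y : RightCosets G}
    (hx : toDoubleCoset G G₀ x ∈ C) : d y ≠ d x * gen₀ := by
  intro hy
  have hyx : y = rightMul G gen₀ x := by rw [← hcos y, hy, coset_mul, hcos]
  -- After a translation the vertex of `x` is `I`, and `x` itself lies to the right of the imaginary
  -- half-axis. Steps at a vertex of type (1) do not move the tested point, and a step at a vertex
  -- of type (0) could change sides only over `I`, where `X'` is cut. The label `d x * gen₀` would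
  -- lie on the left.
  have hpos : 0 < (((d x)⁻¹ * d y) • rho).re := by
    refine cutGraph_edge_induction hX (P := fun z => 0 < (((d x)⁻¹ * d z) • rho).re)
      ?_ ?_ (x₀ := x) ?_ y
    · intro z z' h hz
      rcases hd.cases_of_end₀_eq h with rfl | ⟨hzC, rfl, h1⟩
      · exact hz
      rw [h1, ← mul_assoc, ← smul_rho_re_pos_iff_mul_gen₀]
      · exact hz
      intro hmem
      rw [mem_G₀_iff, inv_mul_eq_one, inv_mul_eq_iff_eq_mul] at hmem
      have hzx : toDoubleCoset G G₀ x = toDoubleCoset G G₀ z := by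
        rcases hmem with h | h
        · rw [← hcos x, h, hcos]
        · refine toDoubleCoset_eq_iff.mpr ⟨gen₀, mem_G₀_iff.mpr (Or.inr rfl), ?_⟩
          rw [← hcos z, h, coset_mul, hcos]
      exact hzC (hzx ▸ hx)
    · intro z z' h hz
      rcases hd.cases_of_end₁_eq h with rfl | ⟨-, ⟨rfl, h1⟩ | ⟨rfl, h1⟩⟩
      · exact hz
      · rwa [h1, ← mul_assoc, mul_smul, gen₁_smul_rho]
      · rwa [h1, ← mul_assoc, mul_smul, gen₁_inv_smul_rho]
    · rw [inv_mul_cancel, one_smul, rho_re]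
      norm_num
  rw [hy, inv_mul_cancel_left, gen₀_smul_rho_re] at hpos
  norm_num at hpos

/-- The graph morphism `X' → T` given by a development. -/
noncomputable def IsDevelopment.hom (hd : IsDevelopment C d) : Hom (cutGraph G C) T where
  v₀ v := QuotientGroup.mk (d (Function.surjInv (cutEnd₀_surjective (C := C)) v))
  v₁ v := QuotientGroup.mk (d (Function.surjInv (cutEnd₁_surjective (C := C)) v))
  e := d
  end₀_e x := by
    change (QuotientGroup.mk (d x) : PSL(2, ℤ) ⧸ G₀) =
      QuotientGroup.mk (d (Function.surjInv (cutEnd₀_surjective (C := C)) (cutEnd₀ C x)))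
    have h := (Function.surjInv_eq (cutEnd₀_surjective (C := C)) (cutEnd₀ C x)).symm
    rw [QuotientGroup.eq, mem_G₀_iff]
    rcases hd.cases_of_end₀_eq h with h | ⟨-, -, h⟩ <;> rw [h] <;> simp
  end₁_e x := by
    change (QuotientGroup.mk (d x) : PSL(2, ℤ) ⧸ G₁) =
      QuotientGroup.mk (d (Function.surjInv (cutEnd₁_surjective (C := C)) (cutEnd₁ C x)))
    have h := (Function.surjInv_eq (cutEnd₁_surjective (C := C)) (cutEnd₁ C x)).symm
    rw [QuotientGroup.eq, mem_G₁_iff]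
    rcases hd.cases_of_end₁_eq h with h | ⟨-, ⟨-, h⟩ | ⟨-, h⟩⟩ <;> rw [h] <;> simp

lemma pt₀_hom_v₀ {ι : Hom (cutGraph G C) treeH} {x : RightCosets G} {g : PSL(2, ℤ)}
    (h : ι.e x = edgeOf g) : pt₀ (ι.v₀ (cutEnd₀ C x)) = g • (I : ℍ) := by
  rw [← pt₀_end₀_edgeOf, ← h]
  exact congrArg pt₀ (ι.end₀_e x).symm

lemma pt₁_hom_v₁ {ι : Hom (cutGraph G C) treeH} {x : RightCosets G} {g : PSL(2, ℤ)}
    (h : ι.e x = edgeOf g) : pt₁ (ι.v₁ (cutEnd₁ C x)) = g • rho := by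
  rw [← pt₁_end₁_edgeOf, ← h]
  exact congrArg pt₁ (ι.end₁_e x).symm

/-- Injectivity on edges holds because `d` is a section of `Γ → G \ Γ`; on vertices of type (1) it
then follows since none is cut, and on those of type (0) from `IsDevelopment.apply_ne`. -/
lemma IsDevelopment.isStandardEmbedding (hX : (cutGraph G C).toSimpleGraph.Connected)
    (hd : IsDevelopment C d) (h1 : d (distEdge G) = 1) :
    IsStandardEmbedding (isoT.comp hd.hom) := by
  have hcos := hd.coset_apply hX (x₀ := distEdge G) (by rw [h1]; rfl)
  have he : ∀ x : RightCosets G, (isoT.comp hd.hom).e x = edgeOf (d x) := fun _ => rfl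
  have hinj : Function.Injective d := fun x y h => by rw [← hcos x, h, hcos]
  refine ⟨?_, ?_, fun x y h => hinj (edgeOf_injective h), ?_, ?_, ?_⟩
  · intro v w h
    obtain ⟨x, rfl⟩ := cutEnd₀_surjective v
    obtain ⟨y, rfl⟩ := cutEnd₀_surjective w
    have h2 := congrArg pt₀ h
    rw [pt₀_hom_v₀ (he x), pt₀_hom_v₀ (he y), smul_I_eq_smul_I_iff] at h2
    rcases h2 with h2 | h2
    · rw [hinj h2]
    · refine cutEnd₀_eq_iff.mpr (Or.inr ⟨fun hC => hd.apply_ne hX hcos hC h2, ?_⟩)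
      rw [← hcos y, h2, coset_mul, hcos]
  · intro v w h
    obtain ⟨x, rfl⟩ := cutEnd₁_surjective v
    obtain ⟨y, rfl⟩ := cutEnd₁_surjective w
    have h2 := congrArg pt₁ h
    rw [pt₁_hom_v₁ (he x), pt₁_hom_v₁ (he y), smul_rho_eq_smul_rho_iff] at h2
    refine cutEnd₁_eq_iff.mpr ?_
    rw [← hcos y]
    rcases h2 with h2 | h2 | h2 <;> rw [h2]
    · exact Or.inl (hcos x)
    · exact Or.inr (Or.inl (by rw [coset_mul, hcos]))
    · exact Or.inr (Or.inr (by rw [coset_mul, hcos]))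
  · exact (pt₀_hom_v₀ (he (distEdge G))).trans (by rw [h1, one_smul])
  · exact (pt₁_hom_v₁ (he (distEdge G))).trans (by rw [h1, one_smul])
  · intro (x : RightCosets G) hx
    have hne : rightMul G gen₁ x ≠ x := by
      intro h
      have h3 := hx.symm.trans (valency₁_eq_one h)
      norm_num at h3
    have hv : (isoT.comp hd.hom).v₁ (cutEnd₁ C x) = treeH.end₁ (edgeOf (d x)) :=
      ((isoT.comp hd.hom).end₁_e x).symm
    change CyclicallyOrdered ((isoT.comp hd.hom).v₁ (cutEnd₁ C x)) (edgeOf (d x))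
      (edgeOf (d (nextEdge G x))) (edgeOf (d (nextEdge G (nextEdge G x))))
    rw [hv, nextEdge_nextEdge, nextEdge_eq, hd.map_gen₁ x hne, hd.map_gen₁_inv hne]
    exact cyclicallyOrdered_edgeOf (d x)

lemma IsStandardEmbedding.exists_isDevelopment {ι : Hom (cutGraph G C) treeH}
    (hι : IsStandardEmbedding ι) : ∃ d : RightCosets G → PSL(2, ℤ), IsDevelopment C d ∧
      d (distEdge G) = 1 ∧ ∀ x : RightCosets G, ι.e x = edgeOf (d x) := by
  have hex : ∀ x : RightCosets G, ∃ g, ι.e x = edgeOf g := fun x => exists_eq_edgeOf _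
  choose d hd using hex
  have hinj : ∀ {x y : RightCosets G}, d x = d y → x = y := by
    intro x y h
    refine hι.injective_e ?_
    exact (hd x).trans ((congrArg edgeOf h).trans (hd y).symm)
  refine ⟨d, ⟨fun x hC hx => ?_, fun x hx => ?_⟩, ?_, hd⟩
  · have h : cutEnd₀ C x = cutEnd₀ C (rightMul G gen₀ x) :=
      cutEnd₀_eq_iff.mpr (Or.inr ⟨hC, rfl⟩)
    have h2 := congrArg (fun v => pt₀ (ι.v₀ v)) h
    beta_reduce at h2
    rw [pt₀_hom_v₀ (hd x), pt₀_hom_v₀ (hd _), smul_I_eq_smul_I_iff] at h2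
    exact h2.resolve_left fun h' => hx (hinj h')
  · have h : ∀ y : RightCosets G, cutEnd₁ C x = cutEnd₁ C y → y ≠ x →
        d y = d x * gen₁ ∨ d y = d x * gen₁⁻¹ := by
      intro y hy hyx
      have h2 := congrArg (fun v => pt₁ (ι.v₁ v)) hy
      beta_reduce at h2
      rw [pt₁_hom_v₁ (hd x), pt₁_hom_v₁ (hd _), smul_rho_eq_smul_rho_iff] at h2
      exact h2.resolve_left fun h' => hyx (hinj h')
    have ha := h (rightMul G gen₁ x) (cutEnd₁_eq_iff.mpr (Or.inr (Or.inl rfl))) hx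
    have hb := h (rightMul G gen₁⁻¹ x) (cutEnd₁_eq_iff.mpr (Or.inr (Or.inr rfl)))
      fun h' => hx (rightMul_gen₁_inv_eq_self_iff.mp h')
    have hab : rightMul G gen₁ x ≠ rightMul G gen₁⁻¹ x := by
      intro h'
      rw [rightMul_eq_iff, rightMul_rightMul, ← mul_inv_rev, gen₁_mul_gen₁, inv_inv] at h'
      exact hx h'.symm
    -- If the next edge had label `d x * gen₁⁻¹`, injectivity would force `d x * gen₁` on the
    -- remaining edge, and the cyclic order would be reversed.
    refine ha.resolve_right fun ha' => ?_
    have hb' : d (rightMul G gen₁⁻¹ x) = d x * gen₁ :=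
      hb.resolve_right fun hb' => hab (hinj (ha'.trans hb'.symm))
    have hc : CyclicallyOrdered (ι.v₁ (cutEnd₁ C x)) (ι.e x) (ι.e (nextEdge G x))
      (ι.e (nextEdge G (nextEdge G x))) := hι.cyclic x (valency₁_eq_three hx)
    have hv : ι.v₁ (cutEnd₁ C x) = treeH.end₁ (edgeOf (d x)) := by
      rw [← hd x]
      exact (ι.end₁_e x).symm
    rw [nextEdge_nextEdge, nextEdge_eq, hd, hd, hd, ha', hb', hv] at hc
    exact not_cyclicallyOrdered_edgeOf _ hc
  · exact eq_one_of_smul_eq ((pt₀_hom_v₀ (hd (distEdge G))).symm.trans hι.base₀)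
      ((pt₁_hom_v₁ (hd (distEdge G))).symm.trans hι.base₁)

/-- Every vertex of `X'` is an extremity of some edge. -/
lemma hom_treeH_ext {ι ι' : Hom (cutGraph G C) treeH} (h : ∀ x : RightCosets G, ι.e x = ι'.e x) :
    ι = ι' := by
  refine Hom.ext (funext fun v => ?_) (funext fun v => ?_) (funext h)
  · obtain ⟨x, rfl⟩ := cutEnd₀_surjective v
    exact (ι.end₀_e x).symm.trans ((congrArg treeH.end₀ (h x)).trans (ι'.end₀_e x))
  · obtain ⟨x, rfl⟩ := cutEnd₁_surjective v
    exact (ι.end₁_e x).symm.trans ((congrArg treeH.end₁ (h x)).trans (ι'.end₁_e x))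

/-- The map from the edges of `X'` to `Γ` given by a morphism `X' → T`. -/
def edgeElt (j : Hom (cutGraph G C) T) (x : RightCosets G) : PSL(2, ℤ) := j.e x

/-- No orientation is needed here: the coset of the label is prescribed, and a wrong choice among
the labels at a vertex would force `x` to be fixed by the generator. -/
lemma IsLift.isDevelopment {j : Hom (cutGraph G C) T} (hj : IsLift j) :
    IsDevelopment C (edgeElt j) := by
  have hcos : ∀ x : RightCosets G, coset G (edgeElt j x) = x := fun x =>
    congrFun (congrArg Hom.e hj) x
  refine ⟨fun x hC hx => ?_, fun x hx => ?_⟩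
  · have h : cutEnd₀ C x = cutEnd₀ C (rightMul G gen₀ x) :=
      cutEnd₀_eq_iff.mpr (Or.inr ⟨hC, rfl⟩)
    have h2 : (QuotientGroup.mk (edgeElt j x) : PSL(2, ℤ) ⧸ G₀) =
        QuotientGroup.mk (edgeElt j (rightMul G gen₀ x)) :=
      (j.end₀_e x).trans ((congrArg j.v₀ h).trans (j.end₀_e (rightMul G gen₀ x)).symm)
    rw [QuotientGroup.eq, mem_G₀_iff, inv_mul_eq_one, inv_mul_eq_iff_eq_mul] at h2
    refine h2.resolve_left fun h' => hx ?_
    have h3 := congrArg (coset G) h'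
    rw [hcos, hcos] at h3
    exact h3.symm
  · have h : cutEnd₁ C x = cutEnd₁ C (rightMul G gen₁ x) :=
      cutEnd₁_eq_iff.mpr (Or.inr (Or.inl rfl))
    have h2 : (QuotientGroup.mk (edgeElt j x) : PSL(2, ℤ) ⧸ G₁) =
        QuotientGroup.mk (edgeElt j (rightMul G gen₁ x)) :=
      (j.end₁_e x).trans ((congrArg j.v₁ h).trans (j.end₁_e (rightMul G gen₁ x)).symm)
    rw [QuotientGroup.eq, mem_G₁_iff, inv_mul_eq_one, inv_mul_eq_iff_eq_mul,
      inv_mul_eq_iff_eq_mul] at h2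
    rcases h2 with h2 | h2 | h2
    · have h3 := congrArg (coset G) h2
      rw [hcos, hcos] at h3
      exact absurd h3.symm hx
    · exact h2
    · have h3 := congrArg (coset G) h2
      rw [hcos, coset_mul, hcos, rightMul_eq_iff, rightMul_rightMul, ← mul_inv_rev,
        gen₁_mul_gen₁, inv_inv] at h3
      exact absurd h3.symm hx

lemma unionOfTriangles_eq {ι : Hom (cutGraph G C) treeH}
    (h : ∀ x : RightCosets G, ι.e x = edgeOf (d x)) :
    unionOfTriangles ι = ⋃ x, d x • triangle := by
  have hset : {g : PSL(2, ℤ) | ∃ x, edgeSet (ι.e x) = g • seg} = Set.range d := by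
    ext g
    constructor
    · rintro ⟨x, hx⟩
      rw [h x] at hx
      exact ⟨x, smul_seg_injective hx⟩
    · rintro ⟨x, rfl⟩
      exact ⟨x, congrArg edgeSet (h x)⟩
  rw [unionOfTriangles, hset, Set.biUnion_range]

lemma carrier_isoT_comp (j : Hom (cutGraph G C) T) :
    carrier (isoT.comp j) = ⋃ k ∈ Set.range (edgeElt j), k • seg := by
  rw [Set.biUnion_range]
  rfl

end

end ModularTree

theorem mainTheorem4 (G : Subgroup PSL(2, ℤ)) (C : Set (Xcomb G).V₀)
    (hC : ∀ v ∈ C, (Xcomb G).valency₀ v = 2) (hX' : (cutGraph G C).IsTree) :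
    (∃! ι : BiGraph.Hom (cutGraph G C) treeH, IsStandardEmbedding ι) ∧
    ∀ ι : BiGraph.Hom (cutGraph G C) treeH, IsStandardEmbedding ι →
      (∀ x, ∃! g : PSL(2, ℤ), edgeSet (ι.e x) = g • seg) ∧
      ∀ p : ℍ → ℍ, IsEquivariantRetraction p →
      ∀ j : BiGraph.Hom (cutGraph G C) T, IsLift j →
        (baseElt j = 1 → polygon p j = unionOfTriangles ι) ∧
        polygon p j = baseElt j • unionOfTriangles ι ∧
        ((∀ v, (cutGraph G C).valency₁ v ≠ 1) →
          p ⁻¹' carrier (isoT.comp j) = baseElt j • unionOfTriangles ι) := by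
  have hX := hX'.2.1
  refine ⟨?_, fun ι hι => ?_⟩
  · obtain ⟨d, hd, h1⟩ := exists_isDevelopment hX'
    refine ⟨_, hd.isStandardEmbedding hX h1, fun ι hι => ?_⟩
    obtain ⟨d', hd', h1', he⟩ := hι.exists_isDevelopment
    refine hom_treeH_ext fun x => (he x).trans ?_
    rw [hd.eq_mul hX hd' h1, h1', one_mul]
    rfl
  obtain ⟨d, hd, h1, he⟩ := hι.exists_isDevelopment
  refine ⟨fun x => ⟨d x, congrArg edgeSet (he x), fun g hg => ?_⟩, fun p hp j hj => ?_⟩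
  · rw [he x] at hg
    exact (smul_seg_injective hg).symm
  -- The development of `ι` is `1` on the distinguished edge, so the constant left factor between
  -- the two developments is the value of `j` there.
  have hjd : ∀ x : RightCosets G, edgeElt j x = baseElt j * d x := hd.eq_mul hX hj.isDevelopment h1
  have hU : (⋃ k ∈ Set.range (edgeElt j), k • triangle) =
      baseElt j • unionOfTriangles ι := by
    rw [Set.biUnion_range, unionOfTriangles_eq he, Set.smul_set_iUnion]
    exact Set.iUnion_congr fun x => by rw [hjd, mul_smul]
  have hP : polygon p j = baseElt j • unionOfTriangles ι := by
    rw [polygon, carrier_isoT_comp, hp.closure_interior_preimage, hU]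
  refine ⟨fun hb => by rw [hP, hb, one_smul], hP, fun hv => ?_⟩
  rw [carrier_isoT_comp, hp.preimage_eq_iUnion, hU]
  -- Without univalent vertices of type (1), `gen₁` fixes no coset, so the set of labels is stable
  -- under right multiplication by `gen₁`.
  rintro _ ⟨x, rfl⟩
  exact ⟨rightMul G gen₁ x,
    hj.isDevelopment.map_gen₁ x fun h => hv _ (valency₁_eq_one h)⟩
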